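/- Let $\mathbb{D}=\{z\in\mathbb{C}:|z|\le 1\}$ be the closed unit disc and let $A(\mathbb{D})$ be the algebra of continuous functions $\mathbb{D}\to\mathbb{C}$ that are analytic in the open disc. Let $\eta:\mathbb{D}\to\mathbb{D}$ be a continuous map that is analytic in the open disc. For $x\in\mathbb{D}$ and $f\in A(\mathbb{D})$ let $\pi_x(f)$ be the operator on $\ell^2(\mathbb{N})$ given by $$\pi_x(f)(\xi_0,\xi_1,\xi_2,\dots)=\bigl(f(x)\xi_0,\ f(\eta(x))\xi_1,\ f(\eta^{(2)}(x))\xi_2,\dots\bigr),$$ where $\eta^{(n)}$ is the $n$-th iterate of $\eta$, and let $U_x$ be the forward shift $U_x(\xi_0,\xi_1,\dots)=(0,\xi_0,\xi_1,\dots)$ on $\ell^2(\mathbb{N})$. The semicrossed product $A(\mathbb{D})\times_\eta\mathbb{Z}^+$ is the norm closed algebra of bounded operators on the Hilbert space $\bigoplus_{x\in\mathbb{D}}\ell^2(\mathbb{N})$ that is generated by the operators $\bigoplus_{x\in\mathbb{D}}\pi_x(f)$ and $\bigoplus_{x\in\mathbb{D}}U_x\pi_x(g)$, $f,g\in A(\mathbb{D})$.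 The map $\eta$ is called elliptic if it has exactly one fixed point in $\mathbb{D}$ and this fixed point lies in the open disc. Let $\eta_1,\eta_2:\mathbb{D}\to\mathbb{D}$ be continuous maps that are analytic in the open disc, and assume that $\eta_1$ is not elliptic. Then $A(\mathbb{D})\times_{\eta_1}\mathbb{Z}^+$ and $A(\mathbb{D})\times_{\eta_2}\mathbb{Z}^+$ are isomorphic as complex algebras (no continuity of the isomorphism is required) if and only if there is a homeomorphism $\gamma:\mathbb{D}\to\mathbb{D}$ that is analytic in the open disc and satisfies $\gamma\circ\eta_1=\eta_2\circ\gamma$. -/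

import Mathlib

open scoped ENNReal

noncomputable section

namespace DiscSemicrossed

/-- The closed unit disc `𝔻` of the complex plane. -/
abbrev Disc : Type := Metric.closedBall (0 : ℂ) 1

/-- `f : 𝔻 → ℂ` is analytic in the open unit disc: its restriction to the open disc is the
restriction of a function on `ℂ` that is analytic at every point of the open disc. -/
def AnalyticInside (f : Disc → ℂ) : Prop :=
  ∃ F : ℂ → ℂ, AnalyticOnNhd ℂ F (Metric.ball 0 1) ∧
    ∀ z : Disc, (z : ℂ) ∈ Metric.ball (0 : ℂ) 1 → f z = F z

/-- The disc algebra `A(𝔻)`: continuous functions on the closed disc, analytic in the interior. -/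
def discAlgebra : Subalgebra ℂ C(Disc, ℂ) where
  carrier := {f | AnalyticInside f}
  mul_mem' := by
    rintro f g ⟨F, hF, hf⟩ ⟨G, hG, hg⟩
    exact ⟨F * G, hF.mul hG, fun z hz => by simp [hf z hz, hg z hz]⟩
  add_mem' := by
    rintro f g ⟨F, hF, hf⟩ ⟨G, hG, hg⟩
    exact ⟨F + G, hF.add hG, fun z hz => by simp [hf z hz, hg z hz]⟩
  algebraMap_mem' := fun c => ⟨fun _ => c, analyticOnNhd_const, fun _ _ => rfl⟩

/-- A self-map of the closed disc is elliptic if it has exactly one fixed point and this fixed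
point lies in the open disc. -/
def IsElliptic (η : C(Disc, Disc)) : Prop :=
  ∃ x : Disc, (x : ℂ) ∈ Metric.ball (0 : ℂ) 1 ∧ ∀ y : Disc, η y = y ↔ y = x

/-- The Hilbert space `ℓ²(ℕ)`. -/
abbrev EllTwo : Type := lp (fun _ : ℕ => ℂ) 2

/-- The Hilbert space direct sum `⨁_{x ∈ 𝔻} ℓ²(ℕ)`. -/
abbrev SumSpace : Type := lp (fun _ : Disc => EllTwo) 2

/-- The operator `π_x(f)` on `ℓ²(ℕ)`, `π_x(f) ξ = (f(x) ξ₀, f(η(x)) ξ₁, f(η²(x)) ξ₂, …)`. -/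
def pointRep (η : C(Disc, Disc)) (x : Disc) (f : C(Disc, ℂ)) : EllTwo →L[ℂ] EllTwo :=
  lp.mapCLM 2 (fun n : ℕ => f (η^[n] x) • ContinuousLinearMap.id ℂ ℂ) (norm_nonneg f)
    (fun n => by
      rw [norm_smul, ContinuousLinearMap.norm_id, mul_one]
      exact f.norm_coe_le_norm _)

theorem norm_pointRep_le (η : C(Disc, Disc)) (x : Disc) (f : C(Disc, ℂ)) :
    ‖pointRep η x f‖ ≤ ‖f‖ :=
  lp.norm_mapCLM_le _ _ _ _

/-- The sequence `(0, ξ₀, ξ₁, …)`. -/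
def shiftSeq (ξ : ℕ → ℂ) : ℕ → ℂ
  | 0 => 0
  | n + 1 => ξ n

theorem hasSum_shiftSeq (ξ : EllTwo) :
    HasSum (fun n => ‖shiftSeq ξ n‖ ^ (2 : ℝ≥0∞).toReal) (‖ξ‖ ^ (2 : ℝ≥0∞).toReal) := by
  rw [← hasSum_nat_add_iff' 1]
  simpa [shiftSeq] using lp.hasSum_norm (p := 2) (by norm_num) ξ

/-- The forward shift `ξ ↦ (0, ξ₀, ξ₁, …)` on `ℓ²(ℕ)`. -/
def forwardShift : EllTwo →L[ℂ] EllTwo :=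
  LinearMap.mkContinuous
    { toFun := fun ξ => ⟨shiftSeq ξ, memℓp_gen (hasSum_shiftSeq ξ).summable⟩
      map_add' := fun ξ ζ => by
        ext n
        cases n
        · exact (add_zero (0 : ℂ)).symm
        · rfl
      map_smul' := fun c ξ => by
        ext n
        cases n <;> simp [shiftSeq] }
    1 (fun ξ => lp.norm_le_of_tsum_le (by norm_num) (by positivity) (by
      rw [one_mul]
      exact (hasSum_shiftSeq ξ).tsum_eq.le))

theorem norm_forwardShift_le : ‖forwardShift‖ ≤ 1 :=
  LinearMap.mkContinuous_norm_le _ zero_le_one _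

/-- The operator `⨁_{x ∈ 𝔻} π_x(f)`. -/
def sumRep (η : C(Disc, Disc)) (f : C(Disc, ℂ)) : SumSpace →L[ℂ] SumSpace :=
  lp.mapCLM 2 (fun x : Disc => pointRep η x f) (norm_nonneg f) (fun x => norm_pointRep_le η x f)

/-- The operator `⨁_{x ∈ 𝔻} U_x π_x(g)`, where every `U_x` is the forward shift. -/
def sumShiftRep (η : C(Disc, Disc)) (g : C(Disc, ℂ)) : SumSpace →L[ℂ] SumSpace :=
  lp.mapCLM 2 (fun x : Disc => forwardShift ∘L pointRep η x g) (norm_nonneg g) (fun x => by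
    have h := ContinuousLinearMap.opNorm_comp_le forwardShift (pointRep η x g)
    have h1 := norm_forwardShift_le
    have h2 := norm_pointRep_le η x g
    nlinarith [norm_nonneg (pointRep η x g)])

/-- The semicrossed product `A(𝔻) ×_η ℤ⁺`: the norm closed algebra of operators on
`⨁_{x ∈ 𝔻} ℓ²(ℕ)` generated by `⨁ π_x(f)` and `⨁ U_x π_x(g)` for `f, g ∈ A(𝔻)`. (The identity
operator is the generator with `f = 1`.) -/
def semicrossedProduct (η : C(Disc, Disc)) : Subalgebra ℂ (SumSpace →L[ℂ] SumSpace) :=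
  (Algebra.adjoin ℂ (sumRep η '' discAlgebra ∪ sumShiftRep η '' discAlgebra)).topologicalClosure

end DiscSemicrossed

end

noncomputable section

namespace DiscSemicrossed

open Metric Filter Topology

/-! Write `U` for the shift, so that `f U = U (f ∘ η)`. A character restricts to evaluation at some
`x` on the disc algebra, and it can be nonzero at `U` only if `η x = x`. Thus the characters form a
base disc (`U ↦ 0`, one for each `x`), with a further disc of values at `U` over every fixed point.
All characters are contractive, so an isomorphism transports them without any continuity assumption.

If one map is the identity, commutativity forces the other to be the identity too. Otherwise fixed
points fill no open set, and the open mapping theorem gives a dichotomy for the transport of an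
analytic disc of characters: it kills `U`, or it stays over a single fixed point
(`eqOn_zero_or_exists_fixed`). If some base character were not sent to a base character, comparing
base discs and fiber discs in both directions would show that `η₁` has exactly one fixed point, in
the open disc, so that it would be elliptic (`baseChar_shiftElem_eq_zero`). Hence base characters
correspond by a bijection `γ` with `γ` and its inverse in the disc algebra.

For the conjugacy, the first Fourier coefficient at `x` is a derivation twisted by the base
characters at `η₁ x` and `x`. It is not inner, being 1 at `U` where both characters vanish, while in
the other algebra a derivation twisted by characters at `u ≠ y` is inner unless `u = η₂ y`
(`twistedDerivation_inner`). Every element is exactly `f + U b` (`exists_eq_functionHom_add`), so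
this algebraic argument needs no continuity. It gives `γ (η₁ x) = η₂ (γ x)` off the fixed points,
and density does the rest.

Conversely, a conjugacy permutes the summands of the Hilbert space, and conjugation by this
permutation matches the generators. -/

/-! ### Functions on the disc -/

open scoped Classical in
/-- Extension of a function on the closed disc by zero. -/
def discExtend (f : Disc → ℂ) (z : ℂ) : ℂ :=
  if h : z ∈ closedBall (0 : ℂ) 1 then f ⟨z, h⟩ else 0

theorem discExtend_of_mem (f : Disc → ℂ) {z : ℂ} (h : z ∈ closedBall (0 : ℂ) 1) :
    discExtend f z = f ⟨z, h⟩ := dif_pos h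

@[simp] theorem discExtend_coe (f : Disc → ℂ) (z : Disc) : discExtend f z = f z :=
  discExtend_of_mem f z.2

theorem analyticInside_iff {f : Disc → ℂ} :
    AnalyticInside f ↔ AnalyticOnNhd ℂ (discExtend f) (ball 0 1) := by
  constructor
  · rintro ⟨F, hF, hf⟩
    refine hF.congr isOpen_ball fun z hz => ?_
    rw [discExtend_of_mem f (ball_subset_closedBall hz)]
    exact (hf ⟨z, ball_subset_closedBall hz⟩ hz).symm
  · exact fun h => ⟨_, h, fun z _ => (discExtend_coe f z).symm⟩

theorem analyticInside_of_eqOn {f : Disc → ℂ} {F : ℂ → ℂ} (hF : DifferentiableOn ℂ F (ball 0 1))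
    (h : ∀ z : Disc, (z : ℂ) ∈ ball (0 : ℂ) 1 → f z = F z) : AnalyticInside f :=
  ⟨F, hF.analyticOnNhd isOpen_ball, h⟩

theorem isPreconnected_unitBall : IsPreconnected (ball (0 : ℂ) 1) :=
  (convex_ball (0 : ℂ) 1).isPreconnected

theorem dense_openDisc : Dense {z : Disc | (z : ℂ) ∈ ball (0 : ℂ) 1} := by
  rw [Subtype.dense_iff]
  intro z hz
  have h : ((↑) '' {z : Disc | (z : ℂ) ∈ ball (0 : ℂ) 1} : Set ℂ) = ball 0 1 := by
    ext w
    simp only [Set.mem_image, Set.mem_ofPred_eq, Subtype.exists]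
    exact ⟨by rintro ⟨a, _, h, rfl⟩; exact h, fun h => ⟨w, ball_subset_closedBall h, h, rfl⟩⟩
  rw [h, closure_ball _ one_ne_zero]
  exact hz

theorem eq_of_eqOn_openDisc {Y : Type*} [TopologicalSpace Y] [T2Space Y] {f g : Disc → Y}
    (hf : Continuous f) (hg : Continuous g)
    (h : ∀ z : Disc, (z : ℂ) ∈ ball (0 : ℂ) 1 → f z = g z) : f = g :=
  Continuous.ext_on dense_openDisc hf hg h

/-- An analytic map from the open disc to the closed disc is constant or has values in the open
disc. -/
theorem eqOn_const_or_mapsTo_ball {F : ℂ → ℂ} (hF : AnalyticOnNhd ℂ F (ball 0 1))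
    (hm : ∀ z ∈ ball (0 : ℂ) 1, F z ∈ closedBall (0 : ℂ) 1) :
    (∃ c, ∀ z ∈ ball (0 : ℂ) 1, F z = c) ∨ Set.MapsTo F (ball 0 1) (ball 0 1) := by
  refine (hF.is_constant_or_isOpen isPreconnected_unitBall).imp id fun h z hz => ?_
  have h1 : F '' ball 0 1 ⊆ interior (closedBall (0 : ℂ) 1) :=
    interior_maximal (by rintro _ ⟨w, hw, rfl⟩; exact hm w hw) (h _ subset_rfl isOpen_ball)
  rw [interior_closedBall _ one_ne_zero] at h1
  exact h1 ⟨z, hz, rfl⟩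

/-- A constant `η` of modulus 1 needs its own case: the interior extension of `f` says nothing at
boundary points. -/
theorem AnalyticInside.comp {f : Disc → ℂ} {η : Disc → Disc} (hf : AnalyticInside f)
    (hη : AnalyticInside fun z => (η z : ℂ)) : AnalyticInside (f ∘ η) := by
  obtain ⟨H, hH, hHη⟩ := hη
  replace hHη : ∀ z : Disc, (z : ℂ) ∈ ball (0 : ℂ) 1 → (η z : ℂ) = H z := hHη
  obtain ⟨F, hF, hFf⟩ := hf
  have hval : ∀ z, ∀ hz : z ∈ ball (0 : ℂ) 1,
      (η ⟨z, ball_subset_closedBall hz⟩ : ℂ) = H z := fun z hz => hHη _ hz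
  rcases eqOn_const_or_mapsTo_ball hH (fun z hz => by rw [← hval z hz]; exact (η _).2) with
    ⟨c, hc⟩ | hm
  · refine analyticInside_of_eqOn (F := fun _ => f (η ⟨0, by simp⟩)) (by fun_prop) fun z hz => ?_
    have : η z = η ⟨0, by simp⟩ :=
      Subtype.ext (by rw [hHη z hz, hc z hz, hHη _ (by simp), hc _ (by simp)])
    simp [this]
  · refine ⟨F ∘ H, hF.comp hH hm, fun z hz => ?_⟩
    have h : (η z : ℂ) ∈ ball (0 : ℂ) 1 := by
      rw [hHη z hz]
      exact hm hz
    simp [hFf _ h, hHη z hz]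

theorem comp_mem_discAlgebra {f : C(Disc, ℂ)} (hf : f ∈ discAlgebra) {η : C(Disc, Disc)}
    (hη : AnalyticInside fun z => (η z : ℂ)) : f.comp η ∈ discAlgebra :=
  AnalyticInside.comp (f := f) (η := η) hf hη

/-- The radial retraction of the plane onto the closed disc. -/
def discRetract (z : ℂ) : Disc :=
  ⟨z / (max 1 ‖z‖ : ℝ), by
    have h : (0 : ℝ) < max 1 ‖z‖ := lt_max_of_lt_left one_pos
    rw [mem_closedBall_zero_iff, norm_div, Complex.norm_real, Real.norm_of_nonneg h.le,
      div_le_one h]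
    exact le_max_right _ _⟩

theorem continuous_discRetract : Continuous discRetract := by
  refine Continuous.subtype_mk ?_ _
  refine continuous_id.div (by fun_prop) fun z => ?_
  exact_mod_cast (lt_max_of_lt_left one_pos : (0 : ℝ) < max 1 ‖z‖).ne'

theorem discRetract_coe (z : Disc) : discRetract z = z := by
  have h : ‖(z : ℂ)‖ ≤ 1 := mem_closedBall_zero_iff.1 z.2
  exact Subtype.ext (by simp [discRetract, max_eq_left h])

/-- There is no continuous branch of `log (ζ - p)` on a circle around `p`. -/
theorem not_exp_eq_sub_of_continuousAt {h : ℂ → ℂ} {p : ℂ} {V : Set ℂ} (hV : V ∈ 𝓝 p)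
    (hc : ∀ ζ ∈ V, ζ ≠ p → ContinuousAt h ζ) (he : ∀ ζ ∈ V, ζ ≠ p → Complex.exp (h ζ) = ζ - p) :
    False := by
  obtain ⟨R, hR, hRV⟩ := nhds_basis_ball.mem_iff.1 hV
  -- `h` is a continuous local inverse of `w ↦ exp w + p`, hence a primitive of `1/(ζ - p)` on the
  -- circle, whose integral is `2πi` and not 0.
  have hd : ∀ ζ ∈ sphere p (R / 2), HasDerivAt h (ζ - p)⁻¹ ζ := by
    intro ζ hζ
    have hζp : ζ ≠ p := by
      rintro rfl
      simp at hζ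
      linarith
    have hζV : ζ ∈ ball p R := by
      rw [mem_sphere] at hζ
      rw [mem_ball, hζ]
      linarith
    have h1 := he ζ (hRV hζV) hζp
    have h2 : HasDerivAt (fun w => Complex.exp w + p) (ζ - p) (h ζ) := by
      have := (Complex.hasDerivAt_exp (h ζ)).add_const p
      rwa [h1] at this
    refine h2.of_local_left_inverse (hc ζ (hRV hζV) hζp) (sub_ne_zero.2 hζp) ?_
    filter_upwards [isOpen_ball.mem_nhds hζV, isOpen_ne.mem_nhds hζp] with y hy hyp
    rw [he y (hRV hy) hyp]
    ring
  have h1 := circleIntegral.integral_eq_zero_of_hasDerivWithinAt (half_pos hR).le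
    (fun ζ hζ => (hd ζ hζ).hasDerivWithinAt)
  rw [circleIntegral.integral_sub_center_inv p (half_pos hR).ne'] at h1
  simp [Complex.I_ne_zero, Real.pi_ne_zero] at h1

/-- A homeomorphism of the closed disc maps boundary points to boundary points: the disc without
a boundary point is simply connected, the disc without an interior point is not. -/
theorem mem_ball_of_homeomorph_apply_mem_ball (γ : Disc ≃ₜ Disc) {b : Disc}
    (h : (γ b : ℂ) ∈ ball (0 : ℂ) 1) : (b : ℂ) ∈ ball (0 : ℂ) 1 := by
  by_contra hb
  have hb1 : ‖(b : ℂ)‖ = 1 :=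
    le_antisymm (mem_closedBall_zero_iff.1 b.2) (by simpa using hb)
  have hbb : (b : ℂ) * (starRingEnd ℂ) b = 1 := by
    rw [Complex.mul_conj, Complex.normSq_eq_norm_sq, hb1]
    simp
  -- `U` is the open half plane cut off by the tangent at `b`. It contains the disc without `b`, and
  -- the radial retraction reaches `b` only from `t b` with `t ≥ 1`, outside `U`.
  let U : Set ℂ := {z | (z * (starRingEnd ℂ) b).re < 1}
  have hUo : IsOpen U := isOpen_lt (by fun_prop) continuous_const
  have hUc : Convex ℝ U := by
    refine convex_halfSpace_lt (f := fun z : ℂ => (z * (starRingEnd ℂ) b).re) ⟨?_, ?_⟩ 1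
    · intro x y
      simp [add_mul]
    · intro c x
      simp
      ring
  have hU : ∀ z ∈ U, discRetract z ≠ b := by
    intro z hz hzb
    have h1 : (0 : ℝ) < max 1 ‖z‖ := lt_max_of_lt_left one_pos
    have h2 : z = (max 1 ‖z‖ : ℝ) * (b : ℂ) := by
      rw [← hzb]
      simp only [discRetract]
      exact (mul_div_cancel₀ z (by exact_mod_cast h1.ne')).symm
    have h3 : (z * (starRingEnd ℂ) b).re = max 1 ‖z‖ := by
      rw [h2, mul_assoc, hbb, mul_one, Complex.ofReal_re, ← h2]
    have h4 : (z * (starRingEnd ℂ) b).re < 1 := hz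
    rw [h3] at h4
    exact absurd h4 (not_lt.2 (le_max_left _ _))
  have hUD : ∀ z : Disc, z ≠ b → (z : ℂ) ∈ U := by
    intro z hz
    have hz1 : ‖(z : ℂ)‖ ≤ 1 := mem_closedBall_zero_iff.1 z.2
    have h1 : ‖(z : ℂ) * (starRingEnd ℂ) b‖ ≤ 1 := by
      rw [norm_mul, RCLike.norm_conj, hb1, mul_one]
      exact hz1
    refine lt_of_le_of_ne ((Complex.re_le_norm _).trans h1) fun h2 => hz ?_
    have h3 : (z : ℂ) * (starRingEnd ℂ) b = 1 := by
      have h4 := Complex.sq_norm_sub_sq_re ((z : ℂ) * (starRingEnd ℂ) b)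
      rw [h2] at h4
      have h5 : ((z : ℂ) * (starRingEnd ℂ) b).im = 0 := by
        have := norm_nonneg ((z : ℂ) * (starRingEnd ℂ) b)
        nlinarith [sq_nonneg ((z : ℂ) * (starRingEnd ℂ) b).im]
      exact Complex.ext h2 h5
    apply Subtype.ext
    calc (z : ℂ) = z * ((b : ℂ) * (starRingEnd ℂ) b) := by rw [hbb, mul_one]
      _ = (z * (starRingEnd ℂ) b) * b := by ring
      _ = b := by rw [h3, one_mul]
  have hsc : IsSimplyConnected U := by
    have : ContractibleSpace U := hUc.contractibleSpace ⟨0, by simp [U]⟩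
    exact inferInstanceAs (SimplyConnectedSpace U)
  obtain ⟨f, hfc, hf⟩ := Complex.exists_continuousOn_eqOn_exp_comp hsc hUo
    (g := fun z => (γ (discRetract z) : ℂ) - γ b)
    (((continuous_subtype_val.comp (γ.continuous.comp continuous_discRetract)).sub
      continuous_const).continuousOn) (by
        rintro ⟨z, hz, hz0⟩
        exact hU z hz (γ.injective (Subtype.ext (sub_eq_zero.1 hz0))))
  have hGU : ∀ ζ ∈ ball (0 : ℂ) 1, ζ ≠ γ b → ((γ.symm (discRetract ζ) : Disc) : ℂ) ∈ U := by
    intro ζ hζ hne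
    refine hUD _ fun h0 => hne ?_
    have h1 := congrArg γ h0
    rw [Homeomorph.apply_symm_apply] at h1
    rw [← h1, discRetract_coe ⟨ζ, ball_subset_closedBall hζ⟩]
  -- Pulling the logarithm of `γ - γ b` back along the inverse of `γ` gives a branch of `log (ζ - γ
  -- b)` around the interior point `γ b`.
  refine not_exp_eq_sub_of_continuousAt (h := fun ζ => f (γ.symm (discRetract ζ)))
    (isOpen_ball.mem_nhds h) (fun ζ hζ hne => ?_) (fun ζ hζ hne => ?_)
  · have h1 : ContinuousAt f ((γ.symm (discRetract ζ) : Disc) : ℂ) :=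
      hfc.continuousAt (hUo.mem_nhds (hGU ζ hζ hne))
    exact h1.comp (f := fun ζ => ((γ.symm (discRetract ζ) : Disc) : ℂ))
      (continuous_subtype_val.comp (γ.symm.continuous.comp continuous_discRetract)).continuousAt
  · have h1 := hf (hGU ζ hζ hne)
    simp only [Function.comp_apply, discRetract_coe, Homeomorph.apply_symm_apply] at h1
    rw [h1, discRetract_coe ⟨ζ, ball_subset_closedBall hζ⟩]

/-- The inverse of a homeomorphism of the closed disc that is analytic inside is analytic inside. -/
theorem AnalyticInside.homeomorph_symm {γ : Disc ≃ₜ Disc}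
    (hγ : AnalyticInside fun z => (γ z : ℂ)) : AnalyticInside fun z => (γ.symm z : ℂ) := by
  have hF : AnalyticOnNhd ℂ (discExtend fun z => (γ z : ℂ)) (ball 0 1) := analyticInside_iff.1 hγ
  set F := discExtend fun z => (γ z : ℂ) with hFdef
  let G : ℂ → ℂ := fun z => (γ.symm (discRetract z) : ℂ)
  have hFv : ∀ z : Disc, F z = γ z := discExtend_coe _
  have hGc : Continuous G :=
    continuous_subtype_val.comp (γ.symm.continuous.comp continuous_discRetract)
  have hFG : ∀ z ∈ ball (0 : ℂ) 1, F (G z) = z := fun z hz => by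
    simp only [G, hFv, Homeomorph.apply_symm_apply]
    rw [discRetract_coe ⟨z, ball_subset_closedBall hz⟩]
  have hGm : ∀ z ∈ ball (0 : ℂ) 1, G z ∈ ball (0 : ℂ) 1 := fun z hz =>
    mem_ball_of_homeomorph_apply_mem_ball γ (by
      rw [Homeomorph.apply_symm_apply, discRetract_coe ⟨z, ball_subset_closedBall hz⟩]
      exact hz)
  have hGinj : Set.InjOn G (ball 0 1) := fun z hz w hw h => by
    rw [← hFG z hz, ← hFG w hw, h]
  have hderiv : ∀ q ∈ ball (0 : ℂ) 1, ∀ᶠ z in 𝓝[≠] q, deriv F z ≠ 0 := by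
    intro q hq
    refine (hF q hq).deriv.eventually_eq_zero_or_eventually_ne_zero.resolve_left fun h0 => ?_
    have h1 : Set.EqOn (deriv F) 0 (ball 0 1) :=
      hF.deriv.eqOn_zero_of_preconnected_of_eventuallyEq_zero isPreconnected_unitBall hq h0
    have h2 : F 0 = F (1 / 2) :=
      isOpen_ball.is_const_of_deriv_eq_zero isPreconnected_unitBall hF.differentiableOn h1
        (by simp) (by simp; norm_num)
    have h3 : F 0 = γ ⟨0, by simp⟩ := hFv ⟨0, by simp⟩
    have h4 : F (1 / 2) = γ ⟨1 / 2, by simp; norm_num⟩ := hFv ⟨1 / 2, by simp; norm_num⟩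
    rw [h3, h4] at h2
    simpa using congrArg Subtype.val (γ.injective (Subtype.ext h2))
  refine ⟨G, fun p hp => ?_, fun z _ => by simp only [G, discRetract_coe]⟩
  -- Zeros of the derivative of `F` are isolated, so `G` is differentiable on a punctured
  -- neighbourhood of `p`; continuity removes the singularity.
  refine Complex.analyticAt_of_differentiable_on_punctured_nhds_of_continuousAt ?_ hGc.continuousAt
  have htends : Tendsto G (𝓝[≠] p) (𝓝[≠] (G p)) := by
    refine tendsto_nhdsWithin_iff.2 ⟨hGc.continuousAt.tendsto.mono_left nhdsWithin_le_nhds, ?_⟩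
    filter_upwards [self_mem_nhdsWithin, mem_nhdsWithin_of_mem_nhds (isOpen_ball.mem_nhds hp)]
      with z hz hzb h
    exact hz (hGinj hzb hp h)
  filter_upwards [htends.eventually (hderiv _ (hGm p hp)),
    mem_nhdsWithin_of_mem_nhds (isOpen_ball.mem_nhds hp)] with z hz hzb
  have h1 : HasDerivAt F (deriv F (G z)) (G z) :=
    (hF _ (hGm z hzb)).differentiableAt.hasDerivAt
  refine (h1.of_local_left_inverse hGc.continuousAt hz ?_).differentiableAt
  filter_upwards [isOpen_ball.mem_nhds hzb] with y hy using hFG y hy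

/-! ### The disc algebra -/

/-- Characters of a closed subalgebra of a Banach algebra are contractive. -/
theorem norm_algHom_subalgebra_le {A : Type*} [NormedRing A] [NormedAlgebra ℂ A] [CompleteSpace A]
    [NormOneClass A] {S : Subalgebra ℂ A} (hS : IsClosed (S : Set A)) (φ : S →ₐ[ℂ] ℂ) (a : S) :
    ‖φ a‖ ≤ ‖a‖ := by
  have : CompleteSpace S := hS.completeSpace_coe
  have h := AlgHom.norm_apply_le_self_mul_norm_one φ a
  have h1 : ‖(1 : S)‖ = 1 := norm_one (α := A)
  rwa [h1, mul_one] at h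

theorem isClosed_discAlgebra : IsClosed (discAlgebra : Set C(Disc, ℂ)) := by
  refine IsSeqClosed.isClosed fun u f hu hf => ?_
  rw [ContinuousMap.tendsto_iff_tendstoUniformly] at hf
  have h : TendstoUniformlyOn (fun n => discExtend (u n)) (discExtend f) atTop (ball 0 1) := by
    rw [Metric.tendstoUniformlyOn_iff]
    intro ε hε
    filter_upwards [Metric.tendstoUniformly_iff.1 hf ε hε] with n hn z hz
    rw [discExtend_of_mem _ (ball_subset_closedBall hz),
      discExtend_of_mem _ (ball_subset_closedBall hz)]
    exact hn _
  refine analyticInside_iff.2 (DifferentiableOn.analyticOnNhd ?_ isOpen_ball)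
  exact h.tendstoLocallyUniformlyOn.differentiableOn
    (Eventually.of_forall fun n => (analyticInside_iff.1 (hu n)).differentiableOn) isOpen_ball

instance : CompleteSpace discAlgebra := isClosed_discAlgebra.completeSpace_coe

/-- The coordinate function of the disc algebra. -/
def discId : discAlgebra :=
  ⟨⟨Subtype.val, continuous_subtype_val⟩, ⟨id, analyticOnNhd_id, fun _ _ => rfl⟩⟩

@[simp] theorem discId_apply (z : Disc) : (discId : C(Disc, ℂ)) z = z := rfl

theorem norm_discId_le : ‖discId‖ ≤ 1 :=
  (ContinuousMap.norm_le _ zero_le_one).2 fun z => mem_closedBall_zero_iff.1 z.2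

/-- Functions in the disc algebra are uniform limits of functions `g` in the disc algebra for which
all `g - g(w)` are divisible by `z - w`. -/
theorem exists_near_divisible (f : discAlgebra) {ε : ℝ} (hε : 0 < ε) :
    ∃ g : discAlgebra, ‖f - g‖ ≤ ε ∧ ∀ w : Disc, ∃ h : discAlgebra,
      g - algebraMap ℂ discAlgebra ((g : C(Disc, ℂ)) w) =
        (discId - algebraMap ℂ discAlgebra w) * h := by
  obtain ⟨δ, hδ, hfδ⟩ := Metric.uniformContinuous_iff.1
    (CompactSpace.uniformContinuous_of_continuous (f : C(Disc, ℂ)).continuous) ε hε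
  obtain ⟨r, hr0, hr1, hrδ⟩ : ∃ r : ℝ, 0 < r ∧ r < 1 ∧ 1 - r < δ := by
    refine ⟨max (1 / 2) (1 - δ / 2), by positivity, max_lt (by norm_num) (by linarith), ?_⟩
    have := le_max_right (1 / 2) (1 - δ / 2)
    linarith
  -- The dilate `f(r z)` is analytic on the ball of radius `1/r`, which contains the closed disc, so
  -- its difference quotients lie in the disc algebra.
  set F : ℂ → ℂ := fun z => discExtend (f : C(Disc, ℂ)) (r * z) with hFdef
  have hmem : ∀ z ∈ ball (0 : ℂ) r⁻¹, (r * z : ℂ) ∈ ball (0 : ℂ) 1 := by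
    intro z hz
    rw [mem_ball_zero_iff] at hz ⊢
    rw [norm_mul, Complex.norm_real, Real.norm_of_nonneg hr0.le]
    calc r * ‖z‖ < r * r⁻¹ := by gcongr
      _ = 1 := mul_inv_cancel₀ hr0.ne'
  have hF : DifferentiableOn ℂ F (ball 0 r⁻¹) :=
    (analyticInside_iff.1 f.2).differentiableOn.comp (by fun_prop) hmem
  have hsub : closedBall (0 : ℂ) 1 ⊆ ball 0 r⁻¹ :=
    closedBall_subset_ball ((one_lt_inv₀ hr0).2 hr1)
  have key : ∀ H : ℂ → ℂ, DifferentiableOn ℂ H (ball 0 r⁻¹) →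
      ∃ h : discAlgebra, ∀ z : Disc, (h : C(Disc, ℂ)) z = H z := by
    intro H hH
    refine ⟨⟨⟨fun z => H z, ?_⟩, analyticInside_of_eqOn (F := H) ?_ fun z _ => rfl⟩, fun z => rfl⟩
    · exact continuousOn_iff_continuous_domRestrict.1 (hH.continuousOn.mono hsub)
    · exact hH.mono (ball_subset_closedBall.trans hsub)
  obtain ⟨g, hg⟩ := key F hF
  refine ⟨g, ?_, fun w => ?_⟩
  · refine (ContinuousMap.norm_le _ hε.le).2 fun z => ?_
    have hz : ‖(z : ℂ)‖ ≤ 1 := mem_closedBall_zero_iff.1 z.2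
    have hrz := ball_subset_closedBall (hmem z (hsub z.2))
    have h1 : (g : C(Disc, ℂ)) z = (f : C(Disc, ℂ)) ⟨r * z, hrz⟩ := by
      rw [hg, hFdef]
      exact discExtend_of_mem _ hrz
    have h2 : dist z ⟨r * z, hrz⟩ < δ := by
      rw [Subtype.dist_eq, dist_eq_norm]
      have : (z : ℂ) - r * z = ((1 - r : ℝ) : ℂ) * z := by push_cast; ring
      simp only [this, norm_mul, Complex.norm_real]
      rw [Real.norm_of_nonneg (by linarith)]
      nlinarith [norm_nonneg (z : ℂ)]
    have h3 := hfδ h2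
    rw [← h1, dist_eq_norm] at h3
    exact h3.le
  · obtain ⟨h, hh⟩ := key (dslope F w)
      ((Complex.differentiableOn_dslope (isOpen_ball.mem_nhds (hsub w.2))).2 hF)
    refine ⟨h, Subtype.ext (ContinuousMap.ext fun z => ?_)⟩
    have h1 : (g : C(Disc, ℂ)) z - (g : C(Disc, ℂ)) w = (z - w) * (h : C(Disc, ℂ)) z := by
      rw [hg, hg, hh]
      exact (sub_smul_dslope F w z).symm
    exact h1

theorem norm_algHom_discAlgebra_le (φ : discAlgebra →ₐ[ℂ] ℂ) (f : discAlgebra) :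
    ‖φ f‖ ≤ ‖f‖ :=
  norm_algHom_subalgebra_le isClosed_discAlgebra φ f

/-- The characters of the disc algebra are the point evaluations. -/
theorem algHom_discAlgebra_eq_eval (φ : discAlgebra →ₐ[ℂ] ℂ) :
    ∃ w : Disc, ∀ f : discAlgebra, φ f = (f : C(Disc, ℂ)) w := by
  refine ⟨⟨φ discId, mem_closedBall_zero_iff.2
    ((norm_algHom_discAlgebra_le φ _).trans norm_discId_le)⟩, fun f => ?_⟩
  set w : Disc := ⟨φ discId, _⟩ with hw
  refine eq_of_sub_eq_zero (norm_le_zero_iff.1 (le_of_forall_pos_le_add fun ε hε => ?_))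
  obtain ⟨g, hfg, hg⟩ := exists_near_divisible f (half_pos hε)
  obtain ⟨h, hh⟩ := hg w
  have h1 : φ g = (g : C(Disc, ℂ)) w := by
    have := congrArg φ hh
    simp only [map_sub, map_mul, AlgHom.commutes, Algebra.algebraMap_self_apply] at this
    rw [show φ discId - (w : ℂ) = 0 from sub_self _, zero_mul] at this
    exact sub_eq_zero.1 this
  have h2 : φ f - (f : C(Disc, ℂ)) w =
      φ (f - g) - ((f - g : discAlgebra) : C(Disc, ℂ)) w := by
    rw [map_sub, h1]
    simp
  have h3 := norm_algHom_discAlgebra_le φ (f - g)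
  have h4 : ‖((f - g : discAlgebra) : C(Disc, ℂ)) w‖ ≤ ‖f - g‖ :=
    ContinuousMap.norm_coe_le_norm _ w
  rw [h2]
  calc _ ≤ _ := norm_sub_le _ _
    _ ≤ 0 + ε := by linarith

/-! ### Fixed points -/

/-- An analytic self-map of the disc that fixes a nonempty open set pointwise is the identity. -/
theorem eq_self_of_eventually_fixed {η : C(Disc, Disc)} (hη : AnalyticInside fun z => (η z : ℂ))
    {c : ℂ} (h : ∀ᶠ z in 𝓝 c, ∃ w : Disc, (w : ℂ) = z ∧ η w = w) (z : Disc) : η z = z := by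
  have hF := analyticInside_iff.1 hη
  have hc : c ∈ ball (0 : ℂ) 1 := by
    rw [← interior_closedBall _ one_ne_zero, mem_interior_iff_mem_nhds]
    filter_upwards [h]
    rintro z ⟨w, rfl, -⟩
    exact w.2
  have h1 : Set.EqOn (discExtend fun z => (η z : ℂ)) id (ball 0 1) := by
    refine hF.eqOn_of_preconnected_of_eventuallyEq analyticOnNhd_id isPreconnected_unitBall hc ?_
    filter_upwards [h]
    rintro z ⟨w, rfl, hw⟩
    simp [hw]
  have h2 : ⇑η = id := eq_of_eqOn_openDisc η.continuous continuous_id fun z hz => by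
    have := h1 hz
    rw [discExtend_coe] at this
    exact Subtype.ext this
  exact congrFun h2 z

/-- If `p` takes values in the fixed points of `η ≠ id` off the zeros of `q`, then `q` vanishes or
`p` is constant. -/
theorem eqOn_zero_or_exists_fixed {η : C(Disc, Disc)} (hη : AnalyticInside fun z => (η z : ℂ))
    (hne : ∃ z, η z ≠ z) {p q : ℂ → ℂ} (hp : AnalyticOnNhd ℂ p (ball 0 1))
    (hq : AnalyticOnNhd ℂ q (ball 0 1))
    (h : ∀ z ∈ ball (0 : ℂ) 1, q z ≠ 0 → ∃ w : Disc, (w : ℂ) = p z ∧ η w = w) :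
    (∀ z ∈ ball (0 : ℂ) 1, q z = 0) ∨
      ∃ w : Disc, η w = w ∧ ∀ z ∈ ball (0 : ℂ) 1, p z = w := by
  by_contra! hcon
  obtain ⟨⟨z₀, hz₀, hqz₀⟩, hcon⟩ := hcon
  have hev : ∀ᶠ z in 𝓝 z₀, ∃ w : Disc, (w : ℂ) = p z ∧ η w = w := by
    filter_upwards [isOpen_ball.mem_nhds hz₀, (hq z₀ hz₀).continuousAt.eventually_ne hqz₀]
      with z hz hqz using h z hz hqz
  -- Near `z₀` the values of `p` are fixed points. If `p` is open there, they fill a neighbourhood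
  -- and `η` is the identity.
  rcases (hp z₀ hz₀).eventually_constant_or_nhds_le_map_nhds with hc | ho
  · obtain ⟨w, hw, hfix⟩ := hev.self_of_nhds
    obtain ⟨z, hz, hpz⟩ := hcon w hfix
    refine hpz ?_
    rw [hw]
    exact hp.eqOn_of_preconnected_of_eventuallyEq analyticOnNhd_const isPreconnected_unitBall
      hz₀ hc hz
  · obtain ⟨z, hz⟩ := hne
    exact hz (eq_self_of_eventually_fixed hη (ho (mem_map.2 hev)) z)

/-! ### The generators of the semicrossed product -/

theorem sumSpace_ext {ξ ζ : SumSpace} (h : ∀ x n, ξ x n = ζ x n) : ξ = ζ :=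
  lp.ext (funext fun x => lp.ext (funext fun n => h x n))

theorem sumRep_apply (η : C(Disc, Disc)) (f : C(Disc, ℂ)) (ξ : SumSpace) (x : Disc) (n : ℕ) :
    sumRep η f ξ x n = f (η^[n] x) * ξ x n := rfl

theorem sumShiftRep_apply_zero (η : C(Disc, Disc)) (g : C(Disc, ℂ)) (ξ : SumSpace) (x : Disc) :
    sumShiftRep η g ξ x 0 = 0 := rfl

theorem sumShiftRep_apply_succ (η : C(Disc, Disc)) (g : C(Disc, ℂ)) (ξ : SumSpace) (x : Disc)
    (n : ℕ) : sumShiftRep η g ξ x (n + 1) = g (η^[n] x) * ξ x n := rfl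

/-- `f ↦ ⨁ π_x(f)` as an algebra homomorphism. -/
def sumRepHom (η : C(Disc, Disc)) : C(Disc, ℂ) →ₐ[ℂ] (SumSpace →L[ℂ] SumSpace) where
  toFun := sumRep η
  map_one' := ContinuousLinearMap.ext fun ξ => sumSpace_ext fun x n => by
    simp [sumRep_apply]
  map_mul' f g := ContinuousLinearMap.ext fun ξ => sumSpace_ext fun x n => by
    simp [sumRep_apply, mul_assoc]
  map_zero' := ContinuousLinearMap.ext fun ξ => sumSpace_ext fun x n => by
    simp [sumRep_apply]
  map_add' f g := ContinuousLinearMap.ext fun ξ => sumSpace_ext fun x n => by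
    simp [sumRep_apply, add_mul]
  commutes' c := ContinuousLinearMap.ext fun ξ => sumSpace_ext fun x n => by
    simp [sumRep_apply, Algebra.algebraMap_eq_smul_one]

theorem norm_sumRep_le (η : C(Disc, Disc)) (f : C(Disc, ℂ)) : ‖sumRep η f‖ ≤ ‖f‖ :=
  lp.norm_mapCLM_le _ _ _ _

theorem isClosed_semicrossedProduct (η : C(Disc, Disc)) :
    IsClosed (semicrossedProduct η : Set (SumSpace →L[ℂ] SumSpace)) :=
  Subalgebra.isClosed_topologicalClosure _

theorem sumRep_mem (η : C(Disc, Disc)) {f : C(Disc, ℂ)} (hf : f ∈ discAlgebra) :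
    sumRep η f ∈ semicrossedProduct η :=
  Subalgebra.le_topologicalClosure _ (Algebra.subset_adjoin (Or.inl ⟨f, hf, rfl⟩))

theorem sumShiftRep_mem (η : C(Disc, Disc)) {f : C(Disc, ℂ)} (hf : f ∈ discAlgebra) :
    sumShiftRep η f ∈ semicrossedProduct η :=
  Subalgebra.le_topologicalClosure _ (Algebra.subset_adjoin (Or.inr ⟨f, hf, rfl⟩))

/-- The embedding of the disc algebra into the semicrossed product. -/
def functionHom (η : C(Disc, Disc)) : discAlgebra →ₐ[ℂ] semicrossedProduct η :=
  ((sumRepHom η).comp discAlgebra.val).codRestrict _ fun f => sumRep_mem η f.2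

/-- The shift, as an element of the semicrossed product. -/
def shiftElem (η : C(Disc, Disc)) : semicrossedProduct η :=
  ⟨sumShiftRep η 1, sumShiftRep_mem η (one_mem _)⟩

theorem sumShiftRep_one_mul_sumRep (η : C(Disc, Disc)) (g : C(Disc, ℂ)) :
    sumShiftRep η 1 * sumRep η g = sumShiftRep η g :=
  ContinuousLinearMap.ext fun ξ => sumSpace_ext fun x n => by
    cases n
    · simp [sumShiftRep_apply_zero]
    · simp [sumShiftRep_apply_succ, sumRep_apply]

theorem sumRep_mul_sumShiftRep_one (η : C(Disc, Disc)) (f : C(Disc, ℂ)) :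
    sumRep η f * sumShiftRep η 1 = sumShiftRep η 1 * sumRep η (f.comp η) :=
  ContinuousLinearMap.ext fun ξ => sumSpace_ext fun x n => by
    cases n
    · simp [sumShiftRep_apply_zero, sumRep_apply]
    · simp [sumShiftRep_apply_succ, sumRep_apply, Function.iterate_succ_apply']

theorem functionHom_mul_shiftElem {η : C(Disc, Disc)} (hη : AnalyticInside fun z => (η z : ℂ))
    (f : discAlgebra) :
    functionHom η f * shiftElem η =
      shiftElem η * functionHom η ⟨(f : C(Disc, ℂ)).comp η, comp_mem_discAlgebra f.2 hη⟩ :=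
  Subtype.ext (sumRep_mul_sumShiftRep_one η f)

theorem norm_forwardShift_apply (ξ : EllTwo) : ‖forwardShift ξ‖ = ‖ξ‖ := by
  have h1 := lp.hasSum_norm (p := 2) (by norm_num) (forwardShift ξ)
  have h3 := h1.unique (hasSum_shiftSeq ξ)
  simpa using (Real.rpow_left_inj (norm_nonneg _) (norm_nonneg _) (by norm_num)).1 h3

theorem norm_sumShiftRep_one_apply (η : C(Disc, Disc)) (ξ : SumSpace) :
    ‖sumShiftRep η 1 ξ‖ = ‖ξ‖ := by
  have h0 : ∀ x, ‖sumShiftRep η 1 ξ x‖ = ‖ξ x‖ := fun x => by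
    have : sumShiftRep η 1 ξ x = forwardShift (ξ x) := lp.ext (funext fun n => by
      cases n
      · rfl
      · exact (one_mul _))
    rw [this, norm_forwardShift_apply]
  rw [lp.norm_eq_tsum_rpow (by norm_num), lp.norm_eq_tsum_rpow (by norm_num)]
  simp_rw [h0]

theorem norm_le_norm_sumShiftRep_one_mul (η : C(Disc, Disc)) (b : SumSpace →L[ℂ] SumSpace) :
    ‖b‖ ≤ ‖sumShiftRep η 1 * b‖ :=
  ContinuousLinearMap.opNorm_le_bound _ (norm_nonneg _) fun ξ => by
    rw [← norm_sumShiftRep_one_apply η (b ξ)]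
    exact (sumShiftRep η 1 * b).le_opNorm ξ

/-! ### Characters of the semicrossed product -/

/-- The sequence of powers of a number of the open disc, conjugated, as a vector of `ℓ²`. -/
def conjPowers (z : ℂ) (hz : ‖z‖ < 1) : EllTwo :=
  ⟨fun n => (starRingEnd ℂ) z ^ n, memℓp_gen (by
    have h : Summable fun n : ℕ => (‖z‖ ^ 2) ^ n :=
      summable_geometric_of_lt_one (by positivity) (by
        rw [sq_lt_one_iff₀ (norm_nonneg z)]; exact hz)
    refine h.congr fun n => ?_
    simp [← pow_mul, mul_comm])⟩

/-- The functional `ξ ↦ ∑ zⁿ ξ_x(n)`. -/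
def powerFunctional (x : Disc) (z : ℂ) (hz : ‖z‖ < 1) : SumSpace →L[ℂ] ℂ :=
  innerSL ℂ (conjPowers z hz) ∘L lp.evalCLM ℂ (fun _ : Disc => EllTwo) 2 x

theorem hasSum_powerFunctional (x : Disc) {z : ℂ} (hz : ‖z‖ < 1) (ξ : SumSpace) :
    HasSum (fun n => z ^ n * ξ x n) (powerFunctional x z hz ξ) := by
  have h := lp.hasSum_inner (𝕜 := ℂ) (conjPowers z hz) (ξ x)
  exact h.congr_fun fun n => by simp [conjPowers, mul_comm]

theorem powerFunctional_sumRep {η : C(Disc, Disc)} {x : Disc} {z : ℂ} (hz : ‖z‖ < 1)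
    (h : z = 0 ∨ η x = x) (f : C(Disc, ℂ)) (ξ : SumSpace) :
    powerFunctional x z hz (sumRep η f ξ) = f x * powerFunctional x z hz ξ := by
  refine (hasSum_powerFunctional x hz _).unique
    (((hasSum_powerFunctional x hz ξ).mul_left (f x)).congr_fun fun n => ?_)
  rw [sumRep_apply]
  rcases h with rfl | h
  -- For `z = 0` only the term `n = 0` survives, as `0 ^ 0 = 1`; no fixed point is needed.
  · cases n <;> simp
  · rw [Function.iterate_fixed h]
    ring

theorem powerFunctional_sumShiftRep {η : C(Disc, Disc)} {x : Disc} {z : ℂ} (hz : ‖z‖ < 1)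
    (h : z = 0 ∨ η x = x) (g : C(Disc, ℂ)) (ξ : SumSpace) :
    powerFunctional x z hz (sumShiftRep η g ξ) = z * g x * powerFunctional x z hz ξ := by
  have h1 := (hasSum_nat_add_iff' 1).2 (hasSum_powerFunctional x hz (sumShiftRep η g ξ))
  simp only [Finset.sum_range_one, sumShiftRep_apply_zero, mul_zero, sub_zero] at h1
  refine h1.unique
    (((hasSum_powerFunctional x hz ξ).mul_left (z * g x)).congr_fun fun n => ?_)
  rw [sumShiftRep_apply_succ]
  rcases h with rfl | h
  · simp
  · rw [Function.iterate_fixed h]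
    ring

/-- The first basis vector of the summand at `x`. -/
def vacuum (x : Disc) : SumSpace := by
  classical exact lp.single 2 x (lp.single 2 0 1)

theorem powerFunctional_vacuum (x : Disc) {z : ℂ} (hz : ‖z‖ < 1) :
    powerFunctional x z hz (vacuum x) = 1 := by
  classical
  refine (hasSum_powerFunctional x hz _).unique ?_
  convert hasSum_single (f := fun n => z ^ n * vacuum x x n) 0 ?_ using 1
  · simp [vacuum]
  · intro n hn
    simp [vacuum, hn]

/-- The functional is an eigenvector of the adjoints of all generators, hence of the closed algebra
they generate. Its value 1 at the vacuum identifies the eigenvalue, which is therefore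
multiplicative in `a`. -/
theorem powerFunctional_apply_eq {η : C(Disc, Disc)} {x : Disc} {z : ℂ} (hz : ‖z‖ < 1)
    (h : z = 0 ∨ η x = x) {a : SumSpace →L[ℂ] SumSpace} (ha : a ∈ semicrossedProduct η)
    (ξ : SumSpace) : powerFunctional x z hz (a ξ) =
      powerFunctional x z hz (a (vacuum x)) * powerFunctional x z hz ξ := by
  refine closure_minimal (t := {a : SumSpace →L[ℂ] SumSpace | powerFunctional x z hz (a ξ) =
      powerFunctional x z hz (a (vacuum x)) * powerFunctional x z hz ξ}) ?_
    (isClosed_eq (by fun_prop) (by fun_prop)) ha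
  intro a ha
  replace ha : a ∈ Algebra.adjoin ℂ (sumRep η '' discAlgebra ∪ sumShiftRep η '' discAlgebra) := ha
  rw [Set.mem_ofPred_eq]
  induction ha using Algebra.adjoin_induction generalizing ξ with
  | mem a ha =>
    rcases ha with ⟨f, -, rfl⟩ | ⟨f, -, rfl⟩
    · simp [powerFunctional_sumRep hz h, powerFunctional_vacuum]
    · simp [powerFunctional_sumShiftRep hz h, powerFunctional_vacuum]
  | algebraMap c => simp [Algebra.algebraMap_eq_smul_one, powerFunctional_vacuum]
  | add a b _ _ iha ihb =>
    simp only [add_apply, map_add]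
    rw [iha ξ, ihb ξ]
    ring
  | mul a b _ _ iha ihb =>
    simp only [mul_apply_eq_comp]
    rw [iha, ihb ξ, iha (b (vacuum x))]
    ring

/-- The character of the semicrossed product with `f ↦ f(x)`, `U ↦ z`; here `x` is a fixed point
of `η` or `z = 0`. -/
def charAt (η : C(Disc, Disc)) (x : Disc) (z : ℂ) (hz : ‖z‖ < 1) (h : z = 0 ∨ η x = x) :
    semicrossedProduct η →ₐ[ℂ] ℂ where
  toFun a := powerFunctional x z hz ((a : SumSpace →L[ℂ] SumSpace) (vacuum x))
  map_one' := by simp [powerFunctional_vacuum]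
  map_mul' a b := by
    simpa using powerFunctional_apply_eq hz h a.2 ((b : SumSpace →L[ℂ] SumSpace) (vacuum x))
  map_zero' := by simp
  map_add' a b := by simp
  commutes' c := by simp [Algebra.algebraMap_eq_smul_one, powerFunctional_vacuum]

theorem charAt_functionHom {η : C(Disc, Disc)} {x : Disc} {z : ℂ} (hz : ‖z‖ < 1)
    (h : z = 0 ∨ η x = x) (f : discAlgebra) :
    charAt η x z hz h (functionHom η f) = (f : C(Disc, ℂ)) x := by
  have := powerFunctional_sumRep hz h f (vacuum x)
  rwa [powerFunctional_vacuum, mul_one] at this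

theorem charAt_shiftElem {η : C(Disc, Disc)} {x : Disc} {z : ℂ} (hz : ‖z‖ < 1)
    (h : z = 0 ∨ η x = x) : charAt η x z hz h (shiftElem η) = z := by
  have := powerFunctional_sumShiftRep hz h 1 (vacuum x)
  rwa [powerFunctional_vacuum, mul_one, ContinuousMap.one_apply, mul_one] at this

/-- The value at `a` of the character with `f ↦ f(x)`, `U ↦ z`, as a power series in `z`. -/
def fiberSeries {η : C(Disc, Disc)} (a : semicrossedProduct η) (x : Disc) (z : ℂ) : ℂ :=
  ∑' n, z ^ n * (a : SumSpace →L[ℂ] SumSpace) (vacuum x) x n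

theorem charAt_apply {η : C(Disc, Disc)} {x : Disc} {z : ℂ} (hz : ‖z‖ < 1)
    (h : z = 0 ∨ η x = x) (a : semicrossedProduct η) :
    charAt η x z hz h a = fiberSeries a x z :=
  (hasSum_powerFunctional x hz _).tsum_eq.symm

theorem analyticOnNhd_fiberSeries {η : C(Disc, Disc)} (a : semicrossedProduct η) (x : Disc) :
    AnalyticOnNhd ℂ (fiberSeries a x) (ball 0 1) := by
  refine DifferentiableOn.analyticOnNhd (fun z hz => ?_) isOpen_ball
  rw [mem_ball_zero_iff] at hz
  obtain ⟨r, hzr, hr⟩ := exists_between hz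
  have hr0 : 0 ≤ r := (norm_nonneg z).trans hzr.le
  set c := (a : SumSpace →L[ℂ] SumSpace) (vacuum x) x
  have h : DifferentiableOn ℂ (fun w : ℂ => ∑' n, w ^ n * c n) (ball 0 r) := by
    refine Complex.differentiableOn_tsum_of_summable_norm (u := fun n => r ^ n * ‖c‖)
      ((summable_geometric_of_lt_one hr0 hr).mul_right _) (fun n => by fun_prop) isOpen_ball ?_
    intro n w hw
    rw [norm_mul, norm_pow]
    gcongr
    · exact (mem_ball_zero_iff.1 hw).le
    · exact lp.norm_apply_le_norm (by norm_num) c n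
  exact (h.differentiableAt (isOpen_ball.mem_nhds
    (mem_ball_zero_iff.2 hzr))).differentiableWithinAt

/-! ### Expansion of elements of the semicrossed product -/

/-- The character `f ↦ f(x)`, `U ↦ 0` of the semicrossed product. -/
def baseChar (η : C(Disc, Disc)) (x : Disc) : semicrossedProduct η →ₐ[ℂ] ℂ :=
  charAt η x 0 (by simp) (Or.inl rfl)

@[simp] theorem baseChar_functionHom (η : C(Disc, Disc)) (x : Disc) (f : discAlgebra) :
    baseChar η x (functionHom η f) = (f : C(Disc, ℂ)) x :=
  charAt_functionHom _ _ f

@[simp] theorem baseChar_shiftElem (η : C(Disc, Disc)) (x : Disc) :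
    baseChar η x (shiftElem η) = 0 :=
  charAt_shiftElem _ _

theorem baseChar_apply (η : C(Disc, Disc)) (x : Disc) (a : semicrossedProduct η) :
    baseChar η x a = (a : SumSpace →L[ℂ] SumSpace) (vacuum x) x 0 := by
  refine (hasSum_powerFunctional x (z := 0) (by simp) _).unique ?_
  convert hasSum_single (f := fun n => (0 : ℂ) ^ n *
    (a : SumSpace →L[ℂ] SumSpace) (vacuum x) x n) 0 ?_ using 1
  · simp
  · intro n hn
    simp [hn]

theorem vacuum_one (x : Disc) : vacuum x x 1 = 0 := by
  classical simp [vacuum]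

theorem vacuum_zero (x : Disc) : vacuum x x 0 = 1 := by
  classical simp [vacuum]

instance : Nontrivial SumSpace :=
  ⟨vacuum ⟨0, by simp⟩, 0, fun h => by
    have h1 := vacuum_zero ⟨0, by simp⟩
    rw [h] at h1
    exact zero_ne_one h1⟩

theorem norm_algHom_semicrossedProduct_le {η : C(Disc, Disc)} (φ : semicrossedProduct η →ₐ[ℂ] ℂ)
    (a : semicrossedProduct η) : ‖φ a‖ ≤ ‖a‖ :=
  norm_algHom_subalgebra_le (isClosed_semicrossedProduct η) φ a

theorem baseChar_functionHom_add (η : C(Disc, Disc)) (x : Disc) (f : discAlgebra)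
    (b : semicrossedProduct η) :
    baseChar η x (functionHom η f + shiftElem η * b) = (f : C(Disc, ℂ)) x := by
  have h : baseChar η x (functionHom η f + shiftElem η * b) =
      baseChar η x (functionHom η f) + baseChar η x (shiftElem η * b) :=
    (baseChar η x).map_add' _ _
  rw [h, map_mul (baseChar η x), baseChar_functionHom, baseChar_shiftElem, zero_mul, add_zero]

/-- Base characters are contractive and recover the values of `f`. -/
theorem norm_le_norm_functionHom_add (η : C(Disc, Disc)) (f : discAlgebra)
    (b : semicrossedProduct η) : ‖f‖ ≤ ‖functionHom η f + shiftElem η * b‖ := by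
  refine (ContinuousMap.norm_le _ (norm_nonneg _)).2 fun x => ?_
  have h := norm_algHom_semicrossedProduct_le (baseChar η x) (functionHom η f + shiftElem η * b)
  rwa [baseChar_functionHom_add] at h

theorem norm_le_two_mul_norm_functionHom_add (η : C(Disc, Disc)) (f : discAlgebra)
    (b : semicrossedProduct η) : ‖b‖ ≤ 2 * ‖functionHom η f + shiftElem η * b‖ := by
  have h1 : ‖b‖ ≤ ‖shiftElem η * b‖ := norm_le_norm_sumShiftRep_one_mul η b
  have h2 := norm_le_norm_functionHom_add η f b
  have h3 : ‖functionHom η f‖ ≤ ‖f‖ := norm_sumRep_le η f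
  have h4 : ‖shiftElem η * b‖ ≤ ‖functionHom η f + shiftElem η * b‖ + ‖functionHom η f‖ := by
    simpa using norm_sub_le (functionHom η f + shiftElem η * b) (functionHom η f)
  linarith

/-- The map `(f, b) ↦ f + U b`. -/
def expansionMap (η : C(Disc, Disc)) :
    (discAlgebra × semicrossedProduct η) →ₗ[ℂ] (SumSpace →L[ℂ] SumSpace) :=
  (semicrossedProduct η).val.toLinearMap ∘ₗ
    (functionHom η).toLinearMap.coprod (LinearMap.mulLeft ℂ (shiftElem η))

theorem expansionMap_apply (η : C(Disc, Disc)) (f : discAlgebra) (b : semicrossedProduct η) :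
    expansionMap η (f, b) = (functionHom η f + shiftElem η * b : semicrossedProduct η) := rfl

/-- Bounding `f` and `b` by `f + U b` makes the map antilipschitz on a complete space. Closedness
turns an expansion on the generated algebra into one on its closure. -/
theorem isClosed_range_expansionMap (η : C(Disc, Disc)) :
    IsClosed (Set.range (expansionMap η)) := by
  have : CompleteSpace (semicrossedProduct η) :=
    (isClosed_semicrossedProduct η).completeSpace_coe
  have h1 : AntilipschitzWith 2 (expansionMap η) :=
    AddMonoidHomClass.antilipschitz_of_bound _ fun ⟨f, b⟩ => by
      have h2 := norm_le_norm_functionHom_add η f b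
      have h3 := norm_le_two_mul_norm_functionHom_add η f b
      refine max_le (h2.trans ?_) h3
      exact le_mul_of_one_le_left (norm_nonneg _) (by norm_num)
  have h4 : LipschitzWith 2 (expansionMap η) :=
    AddMonoidHomClass.lipschitz_of_bound_nnnorm _ 2 fun ⟨f, b⟩ => by
      have h5 : ‖functionHom η f‖ ≤ ‖f‖ := norm_sumRep_le η f
      have h6 : ‖shiftElem η * b‖ ≤ ‖b‖ := by
        refine ContinuousLinearMap.opNorm_le_bound _ (norm_nonneg _) fun ξ => ?_
        have h7 := norm_sumShiftRep_one_apply η ((b : SumSpace →L[ℂ] SumSpace) ξ)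
        exact h7.le.trans ((b : SumSpace →L[ℂ] SumSpace).le_opNorm ξ)
      have h8 : ‖functionHom η f + shiftElem η * b‖ ≤ 2 * ‖(f, b)‖ := by
        have h9 := norm_fst_le (f, b)
        have h10 := norm_snd_le (f, b)
        have h11 := norm_add_le (functionHom η f) (shiftElem η * b)
        simp only at h9 h10
        linarith
      exact_mod_cast h8
  exact h1.isClosed_range h4.uniformContinuous

/-- Every element of the semicrossed product is of the form `f + U b`. -/
theorem exists_eq_functionHom_add {η : C(Disc, Disc)} (hη : AnalyticInside fun z => (η z : ℂ))
    (a : semicrossedProduct η) :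
    ∃ (f : discAlgebra) (b : semicrossedProduct η), a = functionHom η f + shiftElem η * b := by
  suffices h : (a : SumSpace →L[ℂ] SumSpace) ∈ Set.range (expansionMap η) by
    obtain ⟨⟨f, b⟩, h⟩ := h
    exact ⟨f, b, Subtype.ext h.symm⟩
  refine closure_minimal ?_ (isClosed_range_expansionMap η) a.2
  intro a ha
  replace ha : a ∈ Algebra.adjoin ℂ (sumRep η '' discAlgebra ∪ sumShiftRep η '' discAlgebra) := ha
  induction ha using Algebra.adjoin_induction with
  | mem a ha =>
    rcases ha with ⟨f, hf, rfl⟩ | ⟨f, hf, rfl⟩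
    · refine ⟨(⟨f, hf⟩, 0), ?_⟩
      rw [expansionMap_apply, mul_zero, add_zero]
      rfl
    · refine ⟨(0, functionHom η ⟨f, hf⟩), ?_⟩
      rw [expansionMap_apply, map_zero, zero_add]
      exact sumShiftRep_one_mul_sumRep η f
  | algebraMap c =>
    refine ⟨(algebraMap ℂ _ c, 0), ?_⟩
    rw [expansionMap_apply, mul_zero, add_zero, AlgHom.commutes]
    rfl
  | add a b _ _ iha ihb =>
    obtain ⟨p, rfl⟩ := iha
    obtain ⟨q, rfl⟩ := ihb
    exact ⟨p + q, map_add _ _ _⟩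
  | mul a b _ _ iha ihb =>
    obtain ⟨⟨f, b⟩, rfl⟩ := iha
    obtain ⟨⟨g, c⟩, rfl⟩ := ihb
    -- Since `f U = U (f ∘ η)`, the product `(f + U b)(g + U c)` is `f g + U (b g + (f ∘ η) c + b U
    -- c)`.
    refine ⟨(f * g, b * functionHom η g +
      functionHom η ⟨(f : C(Disc, ℂ)).comp η, comp_mem_discAlgebra f.2 hη⟩ * c +
        b * (shiftElem η * c)), ?_⟩
    simp only [expansionMap_apply]
    rw [← MulMemClass.coe_mul]
    congr 1
    have h := functionHom_mul_shiftElem hη f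
    rw [map_mul, add_mul, mul_add, mul_add, mul_add, mul_add, ← mul_assoc (functionHom η f), h]
    simp only [mul_assoc, add_assoc]
    abel

theorem exists_baseChar_eq {η : C(Disc, Disc)} (hη : AnalyticInside fun z => (η z : ℂ))
    (a : semicrossedProduct η) :
    ∃ f : discAlgebra, ∀ x, baseChar η x a = (f : C(Disc, ℂ)) x := by
  obtain ⟨f, b, rfl⟩ := exists_eq_functionHom_add hη a
  exact ⟨f, fun x => baseChar_functionHom_add η x f b⟩

/-- The first Fourier coefficient at `x` of an element of the semicrossed product. -/
def firstCoeff (η : C(Disc, Disc)) (x : Disc) : semicrossedProduct η →ₗ[ℂ] ℂ where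
  toFun a := (a : SumSpace →L[ℂ] SumSpace) (vacuum x) x 1
  map_add' _ _ := rfl
  map_smul' _ _ := rfl

theorem firstCoeff_functionHom (η : C(Disc, Disc)) (x : Disc) (f : discAlgebra) :
    firstCoeff η x (functionHom η f) = 0 := by
  have h := sumRep_apply η f (vacuum x) x 1
  rw [vacuum_one, mul_zero] at h
  exact h

theorem firstCoeff_shiftElem (η : C(Disc, Disc)) (x : Disc) :
    firstCoeff η x (shiftElem η) = 1 := by
  have h := sumShiftRep_apply_succ η 1 (vacuum x) x 0
  rw [vacuum_zero, mul_one] at h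
  exact h

/-- In the summand at `x` the operators are lower triangular; this is the entry (1,0) of a product,
with diagonal entries given by the base characters at `x` and `η x`. -/
theorem firstCoeff_mul {η : C(Disc, Disc)} (hη : AnalyticInside fun z => (η z : ℂ)) (x : Disc)
    (a b : semicrossedProduct η) : firstCoeff η x (a * b) =
      baseChar η (η x) a * firstCoeff η x b + firstCoeff η x a * baseChar η x b := by
  have hU : ∀ c : semicrossedProduct η, firstCoeff η x (shiftElem η * c) = baseChar η x c := by
    intro c
    have h := sumShiftRep_apply_succ η 1 ((c : SumSpace →L[ℂ] SumSpace) (vacuum x)) x 0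
    rw [ContinuousMap.one_apply, one_mul, ← baseChar_apply] at h
    exact h
  have hf : ∀ (f : discAlgebra) (c : semicrossedProduct η),
      firstCoeff η x (functionHom η f * c) = (f : C(Disc, ℂ)) (η x) * firstCoeff η x c :=
    fun f c => sumRep_apply η f ((c : SumSpace →L[ℂ] SumSpace) (vacuum x)) x 1
  obtain ⟨f, c, rfl⟩ := exists_eq_functionHom_add hη a
  rw [add_mul, map_add (firstCoeff η x), hf, mul_assoc, hU, map_add (firstCoeff η x),
    baseChar_functionHom_add, firstCoeff_functionHom, hU, zero_add, map_mul (baseChar η x)]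

/-! ### Arbitrary characters -/

/-- A character applied to `z U = U η(z)` gives `x φ(U) = φ(U) η(x)`. -/
theorem exists_fixed_of_algHom {η : C(Disc, Disc)} (hη : AnalyticInside fun z => (η z : ℂ))
    (φ : semicrossedProduct η →ₐ[ℂ] ℂ) :
    ∃ x : Disc, (∀ f, φ (functionHom η f) = (f : C(Disc, ℂ)) x) ∧
      (φ (shiftElem η) ≠ 0 → η x = x) := by
  obtain ⟨x, hx⟩ := algHom_discAlgebra_eq_eval (φ.comp (functionHom η))
  replace hx : ∀ f, φ (functionHom η f) = (f : C(Disc, ℂ)) x := hx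
  refine ⟨x, hx, fun h => ?_⟩
  have h1 := congrArg φ (functionHom_mul_shiftElem hη discId)
  rw [map_mul, map_mul, hx, hx, mul_comm] at h1
  exact Subtype.ext (mul_left_cancel₀ h h1).symm

/-- On functions a character is a point evaluation, determined by the coordinate function;
contractivity passes from the generated algebra to its closure. -/
theorem algHom_ext_generators {η : C(Disc, Disc)} {φ ψ : semicrossedProduct η →ₐ[ℂ] ℂ}
    (h : φ (functionHom η discId) = ψ (functionHom η discId))
    (hU : φ (shiftElem η) = ψ (shiftElem η)) : φ = ψ := by
  obtain ⟨x, hx⟩ := algHom_discAlgebra_eq_eval (φ.comp (functionHom η))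
  obtain ⟨y, hy⟩ := algHom_discAlgebra_eq_eval (ψ.comp (functionHom η))
  have hxy : x = y := Subtype.ext ((hx discId).symm.trans (h.trans (hy discId)))
  have hf : ∀ f, φ (functionHom η f) = ψ (functionHom η f) := fun f =>
    (hx f).trans ((hy f).trans (by rw [hxy])).symm
  have hle := Subalgebra.le_topologicalClosure
    (Algebra.adjoin ℂ (sumRep η '' discAlgebra ∪ sumShiftRep η '' discAlgebra))
  have hadj : φ.comp (Subalgebra.inclusion hle) = ψ.comp (Subalgebra.inclusion hle) := by
    refine AlgHom.adjoin_ext fun a ha => ?_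
    rcases ha with ⟨f, hf', rfl⟩ | ⟨f, hf', rfl⟩
    · exact hf ⟨f, hf'⟩
    · have h1 : φ (shiftElem η * functionHom η ⟨f, hf'⟩) =
          ψ (shiftElem η * functionHom η ⟨f, hf'⟩) := by
        rw [map_mul, map_mul, hU, hf]
      have h2 : shiftElem η * functionHom η ⟨f, hf'⟩ = ⟨sumShiftRep η f, sumShiftRep_mem η hf'⟩ :=
        Subtype.ext (sumShiftRep_one_mul_sumRep η f)
      rw [h2] at h1
      exact h1
  refine AlgHom.ext fun a => ?_
  refine eq_of_sub_eq_zero (norm_le_zero_iff.1 (le_of_forall_pos_le_add fun ε hε => ?_))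
  obtain ⟨b, hb, hab⟩ := Metric.mem_closure_iff.1 a.2 (ε / 2) (half_pos hε)
  rw [dist_eq_norm] at hab
  let b' : semicrossedProduct η := ⟨b, hle hb⟩
  have hb' : φ b' = ψ b' := DFunLike.congr_fun hadj ⟨b, hb⟩
  have h1 : φ a - ψ a = φ (a - b') - ψ (a - b') := by
    rw [map_sub, map_sub, hb']
    ring
  have h2 := norm_algHom_semicrossedProduct_le φ (a - b')
  have h3 := norm_algHom_semicrossedProduct_le ψ (a - b')
  have h4 : ‖a - b'‖ < ε / 2 := hab
  rw [h1]
  calc _ ≤ _ := norm_sub_le _ _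
    _ ≤ 0 + ε := by linarith

/-! ### The commutative case -/

theorem eq_self_of_commute {η : C(Disc, Disc)} (hη : AnalyticInside fun z => (η z : ℂ))
    (h : functionHom η discId * shiftElem η = shiftElem η * functionHom η discId) (x : Disc) :
    η x = x := by
  have h1 := congrArg (firstCoeff η x) h
  rw [firstCoeff_mul hη, firstCoeff_mul hη, firstCoeff_functionHom, firstCoeff_shiftElem,
    baseChar_functionHom, baseChar_functionHom, baseChar_shiftElem] at h1
  exact Subtype.ext (by simpa using h1)

theorem mul_comm_of_eq_self {η : C(Disc, Disc)} (hη : ∀ x, η x = x) (a b : semicrossedProduct η) :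
    a * b = b * a := by
  have hid : ∀ f : C(Disc, ℂ), f.comp η = f := fun f => ContinuousMap.ext fun x => by simp [hη x]
  have hf : ∀ f g : C(Disc, ℂ), sumRep η f * sumRep η g = sumRep η g * sumRep η f := fun f g => by
    have := congrArg (sumRepHom η) (mul_comm f g)
    rwa [map_mul, map_mul] at this
  have hU : ∀ f : C(Disc, ℂ), sumRep η f * sumShiftRep η 1 = sumShiftRep η 1 * sumRep η f :=
    fun f => by rw [sumRep_mul_sumShiftRep_one, hid]
  have hadj := Algebra.isMulCommutative_adjoin ℂ
    (s := sumRep η '' discAlgebra ∪ sumShiftRep η '' discAlgebra) (by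
      rintro _ (⟨f, -, rfl⟩ | ⟨f, -, rfl⟩) _ (⟨g, -, rfl⟩ | ⟨g, -, rfl⟩)
      · exact hf f g
      · rw [← sumShiftRep_one_mul_sumRep, ← mul_assoc, hU, mul_assoc, hf, mul_assoc]
      · rw [← sumShiftRep_one_mul_sumRep, ← mul_assoc (sumRep η g), hU, mul_assoc, hf, mul_assoc]
      · rw [← sumShiftRep_one_mul_sumRep η f, ← sumShiftRep_one_mul_sumRep η g, mul_assoc,
          ← mul_assoc (sumRep η f), hU, mul_assoc (sumShiftRep η 1) (sumRep η g),
          ← mul_assoc (sumRep η g), hU, mul_assoc, mul_assoc, hf])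
  exact (Subalgebra.commSemiringTopologicalClosure _ hadj.is_comm.comm).mul_comm a b

/-! ### Isomorphisms and characters -/

variable {η₁ η₂ : C(Disc, Disc)}

/-- The dichotomy for the base disc: wherever the transported character is nonzero on the shift, it
lies over a fixed point of `η₂`. -/
theorem baseChar_shiftElem_eq_zero_or_exists_fixed (hη₁ : AnalyticInside fun z => (η₁ z : ℂ))
    (hη₂ : AnalyticInside fun z => (η₂ z : ℂ)) (hne : ∃ z, η₂ z ≠ z)
    (e : semicrossedProduct η₂ →ₐ[ℂ] semicrossedProduct η₁) :
    (∀ x, baseChar η₁ x (e (shiftElem η₂)) = 0) ∨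
      ∃ w : Disc, η₂ w = w ∧ ∀ x, baseChar η₁ x (e (functionHom η₂ discId)) = w := by
  obtain ⟨p, hp⟩ := exists_baseChar_eq hη₁ (e (functionHom η₂ discId))
  obtain ⟨q, hq⟩ := exists_baseChar_eq hη₁ (e (shiftElem η₂))
  rcases eqOn_zero_or_exists_fixed hη₂ hne (analyticInside_iff.1 p.2) (analyticInside_iff.1 q.2)
    (fun z hz hqz => by
      let x : Disc := ⟨z, ball_subset_closedBall hz⟩
      obtain ⟨w, hw, hfix⟩ := exists_fixed_of_algHom hη₂ ((baseChar η₁ x).comp e)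
      have h1 : discExtend (q : C(Disc, ℂ)) x ≠ 0 := hqz
      rw [discExtend_coe, ← hq] at h1
      refine ⟨w, ?_, hfix h1⟩
      have h2 : discExtend (p : C(Disc, ℂ)) x = p.1 x := discExtend_coe _ _
      rw [h2, ← hp]
      exact (hw discId).symm) with h | ⟨w, hfix, hw⟩
  · left
    have h1 : ⇑(q : C(Disc, ℂ)) = fun _ => 0 :=
      eq_of_eqOn_openDisc (q : C(Disc, ℂ)).continuous continuous_const fun z hz => by
        rw [← discExtend_coe (q : C(Disc, ℂ))]
        exact h z hz
    exact fun x => by rw [hq, h1]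
  · right
    have h1 : ⇑(p : C(Disc, ℂ)) = fun _ => (w : ℂ) :=
      eq_of_eqOn_openDisc (p : C(Disc, ℂ)).continuous continuous_const fun z hz => by
        rw [← discExtend_coe (p : C(Disc, ℂ))]
        exact hw z hz
    exact ⟨w, hfix, fun x => by rw [hp, h1]⟩

theorem fiberSeries_shiftElem_eq_zero_or_exists_fixed
    (hη₂ : AnalyticInside fun z => (η₂ z : ℂ)) (hne : ∃ z, η₂ z ≠ z)
    (e : semicrossedProduct η₂ →ₐ[ℂ] semicrossedProduct η₁) {v : Disc} (hv : η₁ v = v) :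
    (∀ z ∈ ball (0 : ℂ) 1, fiberSeries (e (shiftElem η₂)) v z = 0) ∨
      ∃ w : Disc, η₂ w = w ∧
        ∀ z ∈ ball (0 : ℂ) 1, fiberSeries (e (functionHom η₂ discId)) v z = w := by
  refine eqOn_zero_or_exists_fixed hη₂ hne (analyticOnNhd_fiberSeries _ _)
    (analyticOnNhd_fiberSeries _ _) fun z hz hqz => ?_
  have hz' : ‖z‖ < 1 := mem_ball_zero_iff.1 hz
  obtain ⟨w, hw, hfix⟩ := exists_fixed_of_algHom hη₂ ((charAt η₁ v z hz' (Or.inr hv)).comp e)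
  rw [← charAt_apply hz' (Or.inr hv)] at hqz
  refine ⟨w, ?_, hfix hqz⟩
  rw [← charAt_apply hz' (Or.inr hv)]
  exact (hw discId).symm

theorem fiberSeries_zero {η : C(Disc, Disc)} (a : semicrossedProduct η) (x : Disc) :
    fiberSeries a x 0 = baseChar η x a :=
  (charAt_apply _ _ a).symm

/-- An analytic function that is injective on the unit disc is open at the origin. -/
theorem nhds_le_map_of_injOn {g : ℂ → ℂ} (hg : AnalyticOnNhd ℂ g (ball 0 1))
    (hinj : Set.InjOn g (ball 0 1)) : 𝓝 (g 0) ≤ map g (𝓝 0) := by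
  refine ((hg 0 (by simp)).eventually_constant_or_nhds_le_map_nhds).resolve_left fun h => ?_
  obtain ⟨z, ⟨hz1, hz2⟩, hz3⟩ := ((h.and (isOpen_ball.mem_nhds
    (mem_ball_self (x := (0 : ℂ)) one_pos))).filter_mono nhdsWithin_le_nhds |>.and
      (eventually_mem_nhdsWithin (a := (0 : ℂ)) (s := {0}ᶜ))).exists
  exact hz3 (hinj hz2 (by simp) hz1)

/-- Two characters that agree on the images of the generators under an isomorphism agree. -/
theorem eq_of_comp_equiv_eq (e : semicrossedProduct η₂ ≃ₐ[ℂ] semicrossedProduct η₁)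
    {φ ψ : semicrossedProduct η₁ →ₐ[ℂ] ℂ}
    (h : φ (e (functionHom η₂ discId)) = ψ (e (functionHom η₂ discId)))
    (hU : φ (e (shiftElem η₂)) = ψ (e (shiftElem η₂))) : φ = ψ := by
  have h1 : φ.comp e.toAlgHom =
      ψ.comp e.toAlgHom :=
    algHom_ext_generators h hU
  refine AlgHom.ext fun a => ?_
  have h2 := DFunLike.congr_fun h1 (e.symm a)
  simpa using h2

instance : ConnectedSpace Disc :=
  isConnected_iff_connectedSpace.1 ((convex_closedBall (0 : ℂ) 1).isConnected ⟨0, by simp⟩)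

instance : Nontrivial Disc :=
  ⟨⟨0, by simp⟩, ⟨1, by simp⟩, fun h => zero_ne_one (congrArg Subtype.val h)⟩

/-- The base disc and the disc over a fixed point cannot both be mapped into the same fiber. -/
theorem not_base_and_fiber_const (hη₁ : AnalyticInside fun z => (η₁ z : ℂ))
    (e : semicrossedProduct η₂ ≃ₐ[ℂ] semicrossedProduct η₁) {v w : Disc} (hv : η₁ v = v)
    (hbase : ∀ x, baseChar η₁ x (e (functionHom η₂ discId)) = w)
    (hfiber : ∀ z ∈ ball (0 : ℂ) 1, fiberSeries (e (functionHom η₂ discId)) v z = w) : False := by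
  -- All these characters lie over `w` after transport, so the value at the shift alone separates
  -- them.
  have hinj : Set.InjOn (fiberSeries (e (shiftElem η₂)) v) (ball 0 1) := by
    intro z hz z' hz' h
    have h1 : charAt η₁ v z (mem_ball_zero_iff.1 hz) (Or.inr hv) =
        charAt η₁ v z' (mem_ball_zero_iff.1 hz') (Or.inr hv) :=
      eq_of_comp_equiv_eq e (by rw [charAt_apply, charAt_apply, hfiber z hz, hfiber z' hz'])
        (by rw [charAt_apply, charAt_apply, h])
    have h2 := DFunLike.congr_fun h1 (shiftElem η₁)
    rwa [charAt_shiftElem, charAt_shiftElem] at h2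
  have hopen := nhds_le_map_of_injOn (analyticOnNhd_fiberSeries (e (shiftElem η₂)) v) hinj
  obtain ⟨q, hq⟩ := exists_baseChar_eq hη₁ (e (shiftElem η₂))
  -- The fiber disc already fills a neighbourhood of the value at the base point `v`, so a nearby
  -- base character with `x ≠ v` must coincide with a fiber character over `v`.
  have hev : ∀ᶠ x in 𝓝 v, (q : C(Disc, ℂ)) x ∈
      fiberSeries (e (shiftElem η₂)) v '' ball 0 1 := by
    refine (q : C(Disc, ℂ)).continuous.continuousAt.eventually_mem ?_
    rw [← hq, ← fiberSeries_zero]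
    exact hopen (image_mem_map (isOpen_ball.mem_nhds (by simp)))
  obtain ⟨x, ⟨z, hz, hzx⟩, hxv⟩ := ((hev.filter_mono nhdsWithin_le_nhds).and
    (eventually_mem_nhdsWithin (a := v) (s := {v}ᶜ))).exists
  have h1 : charAt η₁ v z (mem_ball_zero_iff.1 hz) (Or.inr hv) = baseChar η₁ x :=
    eq_of_comp_equiv_eq e (by rw [charAt_apply, hfiber z hz, hbase])
      (by rw [charAt_apply, hzx, hq])
  have h2 := DFunLike.congr_fun h1 (functionHom η₁ discId)
  rw [charAt_functionHom, baseChar_functionHom] at h2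
  exact hxv (Subtype.ext h2.symm)

/-- A character whose transport kills the shift is transported to a base character. -/
theorem exists_eq_baseChar (hη₂ : AnalyticInside fun z => (η₂ z : ℂ))
    (e : semicrossedProduct η₂ ≃ₐ[ℂ] semicrossedProduct η₁) (φ : semicrossedProduct η₁ →ₐ[ℂ] ℂ)
    (h : φ (e (shiftElem η₂)) = 0) :
    ∃ y, ∀ a, φ a = baseChar η₂ y (e.symm a) := by
  obtain ⟨y, hy, -⟩ := exists_fixed_of_algHom hη₂
    (φ.comp e.toAlgHom)
  have h1 : φ.comp e.toAlgHom = baseChar η₂ y :=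
    algHom_ext_generators ((hy discId).trans (baseChar_functionHom _ _ _).symm)
      (h.trans (baseChar_shiftElem _ _).symm)
  refine ⟨y, fun a => ?_⟩
  rw [← h1]
  simp

/-- Every base character of the first algebra would come from one of the second, where the
coordinate function takes only the value `w`. -/
theorem not_base_and_const (hη₂ : AnalyticInside fun z => (η₂ z : ℂ))
    (e : semicrossedProduct η₂ ≃ₐ[ℂ] semicrossedProduct η₁)
    (hbase : ∀ x, baseChar η₁ x (e (shiftElem η₂)) = 0) {w : Disc}
    (hconst : ∀ y, baseChar η₂ y (e.symm (functionHom η₁ discId)) = w) : False := by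
  obtain ⟨x, hx⟩ := exists_ne w
  obtain ⟨y, hy⟩ := exists_eq_baseChar hη₂ e (baseChar η₁ x) (hbase x)
  have h := hy (functionHom η₁ discId)
  rw [hconst, baseChar_functionHom] at h
  exact hx (Subtype.ext h)

/-- If `η₁` is not elliptic, then an isomorphism maps base characters to base characters. -/
theorem baseChar_shiftElem_eq_zero (hη₁ : AnalyticInside fun z => (η₁ z : ℂ))
    (hη₂ : AnalyticInside fun z => (η₂ z : ℂ)) (hne₁ : ∃ z, η₁ z ≠ z) (hne₂ : ∃ z, η₂ z ≠ z)
    (hell : ¬ IsElliptic η₁) (e : semicrossedProduct η₂ ≃ₐ[ℂ] semicrossedProduct η₁) (x : Disc) :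
    baseChar η₁ x (e (shiftElem η₂)) = 0 := by
  by_contra hx
  rcases baseChar_shiftElem_eq_zero_or_exists_fixed hη₁ hη₂ hne₂ e.toAlgHom with
    h0 | ⟨w₀, hw₀, hc₀⟩
  · exact hx (h0 x)
  replace hc₀ : ∀ x, baseChar η₁ x (e (functionHom η₂ discId)) = w₀ := hc₀
  rcases baseChar_shiftElem_eq_zero_or_exists_fixed hη₂ hη₁ hne₁ e.symm.toAlgHom with
    h1 | ⟨w₁, hw₁, hc₁⟩
  · exact not_base_and_const hη₁ e.symm h1 hc₀
  replace hc₁ : ∀ y, baseChar η₂ y (e.symm (functionHom η₁ discId)) = w₁ := hc₁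
  -- Both base discs now collapse over the fixed points `w₀` and `w₁`. The fiber over `w₀` shows
  -- that `w₁` is interior; the fiber over any fixed point `v` shows that `v = w₁`.
  refine hell ⟨w₁, ?_, fun v => ⟨fun hv => ?_, fun hv => hv ▸ hw₁⟩⟩
  · rcases fiberSeries_shiftElem_eq_zero_or_exists_fixed hη₁ hne₁ e.symm.toAlgHom hw₀ with
      h2 | ⟨w, -, hw⟩
    · replace h2 : ∀ z ∈ ball (0 : ℂ) 1, fiberSeries (e.symm (shiftElem η₁)) w₀ z = 0 := h2
      -- With the shift killed, the coordinate function separates the fiber disc. Its image is open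
      -- at `w₁` and stays in the closed disc.
      have hinj : Set.InjOn (fiberSeries (e.symm (functionHom η₁ discId)) w₀) (ball 0 1) := by
        intro z hz z' hz' h
        have h3 : charAt η₂ w₀ z (mem_ball_zero_iff.1 hz) (Or.inr hw₀) =
            charAt η₂ w₀ z' (mem_ball_zero_iff.1 hz') (Or.inr hw₀) :=
          eq_of_comp_equiv_eq e.symm (by rw [charAt_apply, charAt_apply, h])
            (by rw [charAt_apply, charAt_apply, h2 z hz, h2 z' hz'])
        have h4 := DFunLike.congr_fun h3 (shiftElem η₂)
        rwa [charAt_shiftElem, charAt_shiftElem] at h4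
      have hopen := nhds_le_map_of_injOn
        (analyticOnNhd_fiberSeries (e.symm (functionHom η₁ discId)) w₀) hinj
      rw [fiberSeries_zero, hc₁] at hopen
      rw [← interior_closedBall _ one_ne_zero, mem_interior_iff_mem_nhds]
      refine hopen (mem_map.2 ?_)
      filter_upwards [isOpen_ball.mem_nhds (mem_ball_self (x := (0 : ℂ)) one_pos)] with z hz
      obtain ⟨u, hu, -⟩ := exists_fixed_of_algHom hη₁
        ((charAt η₂ w₀ z (mem_ball_zero_iff.1 hz) (Or.inr hw₀)).comp e.symm.toAlgHom)
      have h5 : charAt η₂ w₀ z (mem_ball_zero_iff.1 hz) (Or.inr hw₀)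
          (e.symm (functionHom η₁ discId)) = u := hu discId
      rw [charAt_apply] at h5
      rw [Set.mem_preimage, h5]
      exact u.2
    · have h3 : w = w₁ := Subtype.ext (by
        rw [← hw 0 (by simp), fiberSeries_zero]
        exact hc₁ w₀)
      exact (not_base_and_fiber_const hη₂ e.symm hw₀ hc₁ (h3 ▸ hw)).elim
  · rcases fiberSeries_shiftElem_eq_zero_or_exists_fixed hη₂ hne₂ e.toAlgHom hv with
      h2 | ⟨w, -, hw⟩
    · have h3 : baseChar η₁ v (e (shiftElem η₂)) = 0 := by
        rw [← fiberSeries_zero]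
        exact h2 0 (by simp)
      obtain ⟨y, hy⟩ := exists_eq_baseChar hη₂ e (baseChar η₁ v) h3
      have h4 := hy (functionHom η₁ discId)
      rw [hc₁, baseChar_functionHom] at h4
      exact Subtype.ext h4
    · have h3 : w = w₀ := Subtype.ext (by
        rw [← hw 0 (by simp), fiberSeries_zero]
        exact hc₀ v)
      exact (not_base_and_fiber_const hη₁ e hv hc₀ (h3 ▸ hw)).elim

/-! ### Conjugacy -/

/-- Twisted derivations along two base characters `u ≠ y` with `u ≠ η(y)` are inner. -/
theorem twistedDerivation_inner {η : C(Disc, Disc)} (hη : AnalyticInside fun z => (η z : ℂ))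
    {u y : Disc} (huy : u ≠ y) (hu : u ≠ η y) (D : semicrossedProduct η →ₗ[ℂ] ℂ)
    (hD : ∀ a b, D (a * b) = baseChar η u a * D b + D a * baseChar η y b) :
    ∃ c : ℂ, ∀ a, D a = c * (baseChar η u a - baseChar η y a) := by
  have huy' : (u : ℂ) - y ≠ 0 := sub_ne_zero.2 fun h => huy (Subtype.ext h)
  have hDf : ∀ f : discAlgebra, D (functionHom η f) =
      D (functionHom η discId) / (u - y) * ((f : C(Disc, ℂ)) u - (f : C(Disc, ℂ)) y) := by
    intro f
    -- The functions commute, so expanding `D (f z) = D (z f)` expresses `D f` through `D z`.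
    have h : D (functionHom η f * functionHom η discId) =
        D (functionHom η discId * functionHom η f) := by
      rw [← map_mul, ← map_mul, mul_comm]
    simp only [hD, baseChar_functionHom, discId_apply] at h
    field_simp
    linear_combination -h
  -- Applying `D` to `z U = U η(z)` gives `(u - η y) D(U) = 0`.
  have hDU : D (shiftElem η) = 0 := by
    have h := congrArg D (functionHom_mul_shiftElem hη discId)
    simp only [hD, baseChar_functionHom, baseChar_shiftElem, ContinuousMap.comp_apply,
      discId_apply, mul_zero, add_zero, zero_mul, zero_add] at h
    have h1 : ((u : ℂ) - η y) * D (shiftElem η) = 0 := by linear_combination h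
    exact (mul_eq_zero.1 h1).resolve_left (sub_ne_zero.2 fun h => hu (Subtype.ext h))
  refine ⟨D (functionHom η discId) / (u - y), fun a => ?_⟩
  obtain ⟨f, b, rfl⟩ := exists_eq_functionHom_add hη a
  rw [map_add D, hD, hDU, baseChar_shiftElem, hDf, baseChar_functionHom_add,
    baseChar_functionHom_add, zero_mul, zero_mul, add_zero, add_zero]

/-- Were the conjugacy to fail at `x`, the transported first coefficient would be inner; but it is 1
at the shift of the first algebra, where base characters vanish. -/
theorem conj_of_forall_baseChar (hη₁ : AnalyticInside fun z => (η₁ z : ℂ))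
    (hη₂ : AnalyticInside fun z => (η₂ z : ℂ))
    (e : semicrossedProduct η₂ ≃ₐ[ℂ] semicrossedProduct η₁) {γ : Disc → Disc}
    (hinj : Function.Injective γ) (hγ : ∀ x a, baseChar η₁ x (e a) = baseChar η₂ (γ x) a)
    {x : Disc} (hx : η₁ x ≠ x) : γ (η₁ x) = η₂ (γ x) := by
  by_contra hne
  obtain ⟨c, hc⟩ := twistedDerivation_inner hη₂ (fun h => hx (hinj h)) hne
    (firstCoeff η₁ x ∘ₗ e.toLinearMap) (fun a b => by
      simp only [LinearMap.comp_apply, AlgEquiv.toLinearMap_apply, map_mul, firstCoeff_mul hη₁,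
        hγ])
  replace hc : ∀ a, firstCoeff η₁ x a = c * (baseChar η₁ (η₁ x) a - baseChar η₁ x a) := by
    intro a
    have h := hc (e.symm a)
    rw [← hγ, ← hγ] at h
    simpa using h
  have h2 := hc (shiftElem η₁)
  rw [firstCoeff_shiftElem, baseChar_shiftElem, baseChar_shiftElem, sub_zero, mul_zero] at h2
  exact one_ne_zero h2

theorem dense_not_fixed {η : C(Disc, Disc)} (hη : AnalyticInside fun z => (η z : ℂ))
    (hne : ∃ z, η z ≠ z) : Dense {x : Disc | η x ≠ x} := by
  obtain ⟨z, hz⟩ := hne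
  refine dense_iff_inter_open.2 fun U hU hUne => ?_
  obtain ⟨c, hcU, hc⟩ := dense_openDisc.inter_open_nonempty U hU hUne
  obtain ⟨V, hV, rfl⟩ := isOpen_induced_iff.1 hU
  by_contra hcon
  refine hz (eq_self_of_eventually_fixed hη (c := c) ?_ z)
  filter_upwards [hV.mem_nhds hcU, isOpen_ball.mem_nhds hc] with y hyV hy
  refine ⟨⟨y, ball_subset_closedBall hy⟩, rfl, ?_⟩
  by_contra hfix
  exact hcon ⟨⟨y, ball_subset_closedBall hy⟩, hyV, hfix⟩

theorem exists_conj_of_equiv (hη₁ : AnalyticInside fun z => (η₁ z : ℂ))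
    (hη₂ : AnalyticInside fun z => (η₂ z : ℂ)) (hell : ¬ IsElliptic η₁)
    (e : semicrossedProduct η₂ ≃ₐ[ℂ] semicrossedProduct η₁) :
    ∃ γ : Disc ≃ₜ Disc, AnalyticInside (fun z => (γ z : ℂ)) ∧ ⇑γ ∘ ⇑η₁ = ⇑η₂ ∘ ⇑γ := by
  by_cases hid : (∀ z, η₁ z = z) ∨ ∀ z, η₂ z = z
  · have h12 : (∀ z, η₁ z = z) ∧ ∀ z, η₂ z = z := by
      rcases hid with h | h
      · refine ⟨h, eq_self_of_commute hη₂ (e.injective ?_)⟩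
        rw [map_mul, map_mul, mul_comm_of_eq_self h]
      · refine ⟨eq_self_of_commute hη₁ (e.symm.injective ?_), h⟩
        rw [map_mul, map_mul, mul_comm_of_eq_self h]
    refine ⟨Homeomorph.refl _, discId.2, funext fun z => ?_⟩
    simp [h12.1, h12.2]
  push Not at hid
  obtain ⟨hne₁, hne₂⟩ := hid
  have h0 := baseChar_shiftElem_eq_zero hη₁ hη₂ hne₁ hne₂ hell e
  -- Ellipticity of `η₂` is not excluded, so the other direction is deduced from `h0`.
  have h0' : ∀ y, baseChar η₂ y (e.symm (shiftElem η₁)) = 0 := by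
    refine (baseChar_shiftElem_eq_zero_or_exists_fixed hη₂ hη₁ hne₁ e.symm.toAlgHom).resolve_right ?_
    rintro ⟨w, -, hw⟩
    exact not_base_and_const hη₂ e h0 hw
  choose γ hγ using fun x => exists_eq_baseChar hη₂ e (baseChar η₁ x) (h0 x)
  choose δ hδ using fun y => exists_eq_baseChar hη₁ e.symm (baseChar η₂ y) (h0' y)
  have hγe : ∀ x a, baseChar η₁ x (e a) = baseChar η₂ (γ x) a := fun x a => by
    rw [hγ, AlgEquiv.symm_apply_apply]
  have hδe : ∀ y a, baseChar η₂ y (e.symm a) = baseChar η₁ (δ y) a := fun y a => by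
    rw [hδ, AlgEquiv.symm_symm, AlgEquiv.apply_symm_apply]
  have hδγ : ∀ x, δ (γ x) = x := fun x => by
    have h := hγe x (e.symm (functionHom η₁ discId))
    rw [hδe, AlgEquiv.apply_symm_apply, baseChar_functionHom, baseChar_functionHom] at h
    exact Subtype.ext h.symm
  have hγδ : ∀ y, γ (δ y) = y := fun y => by
    have h := hδe y (e (functionHom η₂ discId))
    rw [hγe, AlgEquiv.symm_apply_apply, baseChar_functionHom, baseChar_functionHom] at h
    exact Subtype.ext h.symm
  obtain ⟨p, hp⟩ := exists_baseChar_eq hη₁ (e (functionHom η₂ discId))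
  obtain ⟨p', hp'⟩ := exists_baseChar_eq hη₂ (e.symm (functionHom η₁ discId))
  have hγp : ∀ x, (γ x : ℂ) = (p : C(Disc, ℂ)) x := fun x => by
    rw [← hp, hγe, baseChar_functionHom, discId_apply]
  have hδp : ∀ y, (δ y : ℂ) = (p' : C(Disc, ℂ)) y := fun y => by
    rw [← hp', hδe, baseChar_functionHom, discId_apply]
  have hγc : Continuous γ := by
    rw [continuous_induced_rng]
    exact (p : C(Disc, ℂ)).continuous.congr fun x => (hγp x).symm
  have hδc : Continuous δ := by
    rw [continuous_induced_rng]
    exact (p' : C(Disc, ℂ)).continuous.congr fun x => (hδp x).symm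
  have hinj : Function.Injective γ := Function.LeftInverse.injective hδγ
  refine ⟨⟨⟨γ, δ, hδγ, hγδ⟩, hγc, hδc⟩, ?_, ?_⟩
  · have h : (fun z => (γ z : ℂ)) = (p : C(Disc, ℂ)) := funext hγp
    show AnalyticInside fun z => (γ z : ℂ)
    rw [h]
    exact p.2
  · show γ ∘ η₁ = η₂ ∘ γ
    exact Continuous.ext_on (dense_not_fixed hη₁ hne₁) (hγc.comp η₁.continuous) (η₂.continuous.comp hγc)
      fun x hx => conj_of_forall_baseChar hη₁ hη₂ e hinj hγe hx

/-! ### Isomorphisms from conjugacies -/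

theorem hasSum_permute (σ : Disc ≃ Disc) (ξ : SumSpace) :
    HasSum (fun x => ‖ξ (σ x)‖ ^ (2 : ℝ≥0∞).toReal) (‖ξ‖ ^ (2 : ℝ≥0∞).toReal) :=
  σ.hasSum_iff.2 (lp.hasSum_norm (p := 2) (by norm_num) ξ)

/-- The operator that permutes the summands. -/
def permute (σ : Disc ≃ Disc) : SumSpace →L[ℂ] SumSpace :=
  LinearMap.mkContinuous
    { toFun := fun ξ => ⟨fun x => ξ (σ x), memℓp_gen (hasSum_permute σ ξ).summable⟩
      map_add' := fun _ _ => rfl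
      map_smul' := fun _ _ => rfl }
    1 (fun ξ => lp.norm_le_of_tsum_le (by norm_num) (by positivity) (by
      rw [one_mul]
      exact (hasSum_permute σ ξ).tsum_eq.le))

theorem permute_apply (σ : Disc ≃ Disc) (ξ : SumSpace) (x : Disc) :
    permute σ ξ x = ξ (σ x) := rfl

/-- Conjugation by the permutation of the summands. -/
def permuteConj (σ : Disc ≃ Disc) : (SumSpace →L[ℂ] SumSpace) ≃A[ℂ] (SumSpace →L[ℂ] SumSpace) :=
  (ContinuousLinearEquiv.equivOfInverse (permute σ) (permute σ.symm)
    (fun ξ => sumSpace_ext fun x n => by simp [permute_apply])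
    (fun ξ => sumSpace_ext fun x n => by simp [permute_apply])).conjContinuousAlgEquiv

theorem permuteConj_apply (σ : Disc ≃ Disc) (a : SumSpace →L[ℂ] SumSpace) (ξ : SumSpace) :
    permuteConj σ a ξ = permute σ (a (permute σ.symm ξ)) := rfl

theorem permuteConj_symm_apply (σ : Disc ≃ Disc) (a : SumSpace →L[ℂ] SumSpace) :
    permuteConj σ.symm (permuteConj σ a) = a :=
  ContinuousLinearMap.ext fun ξ => sumSpace_ext fun x n => by
    have h : ∀ ζ : SumSpace, permute σ.symm (permute σ ζ) = ζ := fun ζ =>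
      sumSpace_ext fun x n => by simp [permute_apply]
    simp only [permuteConj_apply, h, Equiv.symm_symm]

variable {γ : Disc ≃ₜ Disc}

theorem permuteConj_sumRep (h : Function.Semiconj γ η₂ η₁) (f : C(Disc, ℂ)) :
    permuteConj γ.toEquiv (sumRep η₁ f) = sumRep η₂ (f.comp (γ : C(Disc, Disc))) :=
  ContinuousLinearMap.ext fun ξ => sumSpace_ext fun x n => by
    have h1 : η₁^[n] (γ x) = γ (η₂^[n] x) := (h.iterate_right n x).symm
    simp [permuteConj_apply, permute_apply, sumRep_apply, h1]

theorem permuteConj_sumShiftRep (h : Function.Semiconj γ η₂ η₁) (f : C(Disc, ℂ)) :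
    permuteConj γ.toEquiv (sumShiftRep η₁ f) = sumShiftRep η₂ (f.comp (γ : C(Disc, Disc))) :=
  ContinuousLinearMap.ext fun ξ => sumSpace_ext fun x n => by
    cases n with
    | zero => rfl
    | succ n =>
      have h1 : η₁^[n] (γ x) = γ (η₂^[n] x) := (h.iterate_right n x).symm
      simp [permuteConj_apply, permute_apply, sumShiftRep_apply_succ, h1]

theorem permuteConj_mem (hγ : AnalyticInside fun z => (γ z : ℂ)) (h : Function.Semiconj γ η₂ η₁)
    {a : SumSpace →L[ℂ] SumSpace} (ha : a ∈ semicrossedProduct η₁) :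
    permuteConj γ.toEquiv a ∈ semicrossedProduct η₂ := by
  have hmem : ∀ f ∈ discAlgebra, f.comp (γ : C(Disc, Disc)) ∈ discAlgebra :=
    fun f hf => comp_mem_discAlgebra hf hγ
  have hle : (Algebra.adjoin ℂ (sumRep η₁ '' discAlgebra ∪ sumShiftRep η₁ '' discAlgebra) :
      Set (SumSpace →L[ℂ] SumSpace)) ⊆ permuteConj γ.toEquiv ⁻¹' (semicrossedProduct η₂) := by
    refine Algebra.adjoin_le (S := (semicrossedProduct η₂).comap
      (permuteConj γ.toEquiv).toAlgEquiv.toAlgHom) ?_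
    rintro _ (⟨f, hf, rfl⟩ | ⟨f, hf, rfl⟩)
    · have h1 := sumRep_mem η₂ (hmem f hf)
      rw [← permuteConj_sumRep h] at h1
      exact h1
    · have h1 := sumShiftRep_mem η₂ (hmem f hf)
      rw [← permuteConj_sumShiftRep h] at h1
      exact h1
  exact closure_minimal hle ((isClosed_semicrossedProduct η₂).preimage
    (permuteConj γ.toEquiv).continuous) ha

/-- Both `γ` and its inverse must preserve the disc algebra under composition, which is where
analyticity of the inverse enters. -/
theorem nonempty_equiv_of_conj (hγ : AnalyticInside fun z => (γ z : ℂ))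
    (h : ⇑γ ∘ ⇑η₁ = ⇑η₂ ∘ ⇑γ) :
    Nonempty (semicrossedProduct η₁ ≃ₐ[ℂ] semicrossedProduct η₂) := by
  have h1 : Function.Semiconj γ η₁ η₂ := fun x => congrFun h x
  have h2 : Function.Semiconj γ.symm η₂ η₁ := fun y => by
    apply γ.injective
    rw [h1, Homeomorph.apply_symm_apply, Homeomorph.apply_symm_apply]
  refine ⟨AlgEquiv.ofAlgHom
    (((permuteConj γ.symm.toEquiv).toAlgEquiv.toAlgHom.comp
      (semicrossedProduct η₁).val).codRestrict _
      fun a => permuteConj_mem hγ.homeomorph_symm h2 a.2)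
    (((permuteConj γ.toEquiv).toAlgEquiv.toAlgHom.comp
      (semicrossedProduct η₂).val).codRestrict _ fun a => permuteConj_mem hγ h1 a.2)
    (AlgHom.ext fun a => Subtype.ext ?_) (AlgHom.ext fun a => Subtype.ext ?_)⟩
  · exact permuteConj_symm_apply γ.toEquiv a
  · exact permuteConj_symm_apply γ.symm.toEquiv a

end DiscSemicrossed

end

open DiscSemicrossed in
theorem mainTheorem7 (η₁ η₂ : C(Disc, Disc))
    (hη₁ : AnalyticInside (fun z => (η₁ z : ℂ))) (hη₂ : AnalyticInside (fun z => (η₂ z : ℂ)))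
    (hell : ¬ IsElliptic η₁) :
    Nonempty (semicrossedProduct η₁ ≃ₐ[ℂ] semicrossedProduct η₂) ↔
      ∃ γ : Disc ≃ₜ Disc, AnalyticInside (fun z => (γ z : ℂ)) ∧ ⇑γ ∘ ⇑η₁ = ⇑η₂ ∘ ⇑γ :=
  ⟨fun ⟨Φ⟩ => exists_conj_of_equiv hη₁ hη₂ hell Φ.symm,
    fun ⟨_, hγ, h⟩ => nonempty_equiv_of_conj hγ h⟩
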